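/- Let $\mathbb H=\mathbb H_1\times\cdots\times\mathbb H_m$ and $\mathbb G=\mathbb G_1\times\cdots\times\mathbb G_p$ be products of finite-dimensional real Hilbert spaces, $\mathbb F=\mathbb H\times\mathbb G$, and let $A:\mathbb H\to\mathbb G$ be linear. Let $f:\mathbb H\to\mathbb R$ be convex and differentiable with Lipschitz gradient, and let $g:\mathbb H\to(-\infty,+\infty]$ and $h:\mathbb G\to[-\infty,+\infty]$ be such that $g$ and the conjugate $h^*$ are closed proper convex. Consider $$\min_{x\in\mathbb H}\ f(x)+g(x)+h(Ax),$$ and let $$Z^*=\{(x,s)\in\mathbb F:\ -\nabla f(x)-A^\top s\in\partial g(x),\ Ax\in\partial h^*(s)\}$$ be its set of primal-dual solutions, assumed nonempty. For $\eta,\gamma>0$ let $\mathcal T_{\mathrm{CV}}(x,s)=(x^+,s^+)$, where $$s^+=\mathbf{prox}_{\gamma h^*}(s+\gamma Ax),\qquad x^+=\mathbf{prox}_{\eta g}\bigl(x-\eta(\nabla f(x)+A^\top(2s^+-s))\bigr),$$ and let $M=\begin{bmatrix}\frac1\eta I&A^\top\\A&\frac1\gamma I\end{bmatrix}$. Assume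 that $\eta,\gamma$ are chosen such that $M\succ0$ and $\mathcal T_{\mathrm{CV}}$ is nonexpansive for the norm $\|z\|_M=\sqrt{\langle z,Mz\rangle}$. Let $\kappa=\lambda_{\max}(M)/\lambda_{\min}(M)$. Let $(q_i)$ be a probability distribution with all $q_i>0$ on the set of blocks, $q_{\min}=\min_iq_i$, let $z^0\in\mathbb F$ be fixed, and let the blocks $i_0,i_1,\dots$ be random with $\mathrm{Prob}(i_k=i)=q_i$. At iteration $k$ an update is computed from a cached copy $\hat z^k=(\hat x^k,\hat s^k)$ of the memory with delay at most $\tau\in\{0,1,2,\dots\}$: either every coordinate satisfies $\hat z^k_i=z_i^{k-d_i^k}$ with $0\le d_i^k\le\tau$ (where $z^l=z^0$ for $l<0$), or $\hat z^k=z^k+\sum_{d\in J(k)}(z^d-z^{d+1})$ with $J(k)\subseteq\{k-1,\dots,k-\tau\}\cap\{0,1,2,\dots\}$. Assume that $i_k$ is independent of the past $\mathcal F_k$, where $(\mathcal F_k)$ is a filtration such that $\hat z^k$ is $\mathcal F_k$-measurable and $i_k$ is $\mathcal F_{k+1}$-measurable. Let $(z^k)_{k\ge0}$ be generated by one of the following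 two algorithms. 1. There are $n=m+p$ blocks, namely the coordinates $z=(x_1,\dots,x_m,s_1,\dots,s_p)$. With $i=i_k$, set $z_i^{k+1}=z_i^k-\frac{\eta_k}{(m+p)q_i}\bigl(\hat z^k-\mathcal T_{\mathrm{CV}}\hat z^k\bigr)_i$, and leave the other coordinates unchanged. 2. There are $n=m$ overlapping blocks, and $g(x)=\sum_ig_i(x_i)$, $h^*(s)=\sum_jh_j^*(s_j)$. Put $\mathbb J(i)=\{j:(A^\top)_{i,j}\ne0\}$, $\mathbb I(j)=\{i:(A^\top)_{i,j}\neq0\}$, and let $\rho_{i,j}\ge0$ satisfy $\sum_{i\in\mathbb I(j)}\rho_{i,j}=1$ for all $j$. With $i=i_k$, compute $\tilde s_j=\mathbf{prox}_{\gamma h_j^*}(\hat s^k_j+\gamma(A\hat x^k)_j)$ for $j\in\mathbb J(i)$ and $\tilde x_i=\mathbf{prox}_{\eta g_i}\bigl(\hat x^k_i-\eta(\nabla_if(\hat x^k)+\sum_{j\in\mathbb J(i)}(A^\top)_{i,j}(2\tilde s_j-\hat s^k_j))\bigr)$. Set $x_i^{k+1}=x_i^k+\frac{\eta_k}{mq_i}(\tilde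 x_i-\hat x^k_i)$ and $s_j^{k+1}=s_j^k+\frac{\rho_{i,j}\eta_k}{mq_i}(\tilde s_j-\hat s_j^k)$ for $j\in\mathbb J(i)$, and leave everything else unchanged. Suppose that the step sizes satisfy $\eta_k\in[\eta_{\min},\eta_{\max}]$ for all $k$, where $$0<\eta_{\min}\le\eta_{\max}<\frac{n\,q_{\min}}{2\tau\sqrt{\kappa q_{\min}}+\kappa}.$$ Then, for either algorithm, $(z^k)_{k\ge0}$ converges with probability $1$ to a $Z^*$-valued random variable. Moreover, if $h$ is closed proper convex, then for every $(x,s)\in Z^*$ the point $x$ minimizes $f+g+h\circ A$. -/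

import Mathlib

open MeasureTheory ProbabilityTheory Filter Topology

namespace AsyncPD

noncomputable section

/-! ### Convex analysis -/

section ConvexAnalysis

variable {E : Type*} [NormedAddCommGroup E] [InnerProductSpace ℝ E]

/-- Closed proper convex extended-real-valued functions: the epigraph is convex, the function is
lower semicontinuous, never `-∞`, and not identically `+∞`. -/
structure ClosedProperConvex (φ : E → EReal) : Prop where
  convex : Convex ℝ {w : E × ℝ | φ w.1 ≤ (w.2 : EReal)}
  closed : LowerSemicontinuous φ
  ne_bot : ∀ x, φ x ≠ ⊥
  exists_ne_top : ∃ x, φ x ≠ ⊤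

/-- The convex subdifferential `∂φ(x)`. -/
def subdiff (φ : E → EReal) (x : E) : Set E :=
  {u | ∀ y, φ x + ((inner ℝ u (y - x) : ℝ) : EReal) ≤ φ y}

/-- The convex conjugate `h*(s) = sup_y (⟨s, y⟩ - h(y))`. -/
def conj (h : E → EReal) (s : E) : EReal :=
  ⨆ y, (((inner ℝ s y : ℝ) : EReal) - h y)

/-- The proximal map `prox_{γφ}(y) = argmin_u { φ(u) + ‖u - y‖² / (2γ) }`.  (The minimiser exists
and is unique if `φ` is closed, proper and convex and `γ > 0`.) -/
def prox (γ : ℝ) (φ : E → EReal) (y : E) : E :=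
  Classical.epsilon fun x =>
    IsMinOn (fun u => φ u + ((1 / (2 * γ) * ‖u - y‖ ^ 2 : ℝ) : EReal)) Set.univ x

end ConvexAnalysis

/-! ### The primal-dual operator and its metric -/

section PrimalDual

variable {X Y : Type*} [NormedAddCommGroup X] [InnerProductSpace ℝ X] [CompleteSpace X]
  [NormedAddCommGroup Y] [InnerProductSpace ℝ Y] [CompleteSpace Y]

/-- The Condat–Vũ operator `(x, s) ↦ (x⁺, s⁺)`, where
`s⁺ = prox_{γ h*}(s + γ A x)` and `x⁺ = prox_{η g}(x - η (∇f(x) + Aᵀ(2 s⁺ - s)))`. -/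
def condatVu (f : X → ℝ) (g : X → EReal) (h : Y → EReal) (A : X →L[ℝ] Y) (η γ : ℝ)
    (z : WithLp 2 (X × Y)) : WithLp 2 (X × Y) :=
  let s' : Y := prox γ (conj h) (z.snd + γ • A z.fst)
  let x' : X := prox η g
    (z.fst - η • (gradient f z.fst + A.adjoint ((2 : ℝ) • s' - z.snd)))
  WithLp.toLp 2 (x', s')

/-- The primal-dual solutions `z = (x, s)` of `minimize f(x) + g(x) + h(Ax)`: the pairs with
`0 ∈ ∇f(x) + ∂g(x) + Aᵀ s` and `0 ∈ ∂h*(s) - A x`. -/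
def solutionSet (f : X → ℝ) (g : X → EReal) (h : Y → EReal) (A : X →L[ℝ] Y) :
    Set (WithLp 2 (X × Y)) :=
  {z | -(gradient f z.fst + A.adjoint z.snd) ∈ subdiff g z.fst ∧
    A z.fst ∈ subdiff (conj h) z.snd}

/-- The metric `M = [I/η, Aᵀ; A, I/γ]`. -/
def metric (A : X →L[ℝ] Y) (η γ : ℝ) : WithLp 2 (X × Y) →ₗ[ℝ] WithLp 2 (X × Y) where
  toFun z := WithLp.toLp 2
    ((1 / η) • z.fst + A.adjoint z.snd, A z.fst + (1 / γ) • z.snd)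
  map_add' z w := by
    apply (WithLp.equiv 2 (X × Y)).injective
    refine Prod.ext ?_ ?_
    · simp; abel
    · simp; abel
  map_smul' c z := by
    apply (WithLp.equiv 2 (X × Y)).injective
    refine Prod.ext ?_ ?_
    · simp [smul_smul, mul_comm]
    · simp [smul_smul, mul_comm]

end PrimalDual

section Metric

variable {F : Type*} [NormedAddCommGroup F] [InnerProductSpace ℝ F]

/-- `M ≻ 0` (for an operator that is symmetric). -/
def PosDefOp (M : F →ₗ[ℝ] F) : Prop := ∀ z, z ≠ 0 → 0 < inner ℝ z (M z)

/-- The norm `‖z‖_M = √⟨z, M z⟩`. -/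
def normM (M : F →ₗ[ℝ] F) (z : F) : ℝ := √(inner ℝ z (M z))

/-- `T` is nonexpansive under the norm induced by `M`. -/
def NonexpansiveUnder (M : F →ₗ[ℝ] F) (T : F → F) : Prop :=
  ∀ z w, normM M (T z - T w) ≤ normM M (z - w)

/-- The condition number `λ_max / λ_min`: largest over smallest eigenvalue. -/
def condNumber (M : F →ₗ[ℝ] F) : ℝ :=
  sSup {μ : ℝ | Module.End.HasEigenvalue M μ} / sInf {μ : ℝ | Module.End.HasEigenvalue M μ}

end Metric

/-- The step-size threshold `n q_min / (2 τ √(κ q_min) + κ)`, where `n` is the number of blocks and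
`q_min` the smallest block probability. -/
def stepBound {ι : Type*} [Fintype ι] (q : ι → ℝ) (τ : ℕ) (κ : ℝ) : ℝ :=
  (Fintype.card ι : ℝ) * (⨅ i, q i) / (2 * (τ : ℝ) * √(κ * ⨅ i, q i) + κ)

/-! ### Blocks, delayed reads, and the two algorithms -/

section Algorithms

variable {m p : ℕ} {H : Fin m → Type*} {G : Fin p → Type*}
  [∀ i, NormedAddCommGroup (H i)] [∀ i, InnerProductSpace ℝ (H i)]
  [∀ j, NormedAddCommGroup (G j)] [∀ j, InnerProductSpace ℝ (G j)]

/-- The primal-dual space `(H₁ × ⋯ × H_m) × (G₁ × ⋯ × G_p)` with its Hilbert structure. -/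
abbrev PDSpace {m p : ℕ} (H : Fin m → Type*) (G : Fin p → Type*) : Type _ :=
  WithLp 2 (PiLp 2 H × PiLp 2 G)

/-- The cached copy `zh` used at iteration `k` has coordinatewise delays at most `τ`.
(`k - d` is truncated, i.e. `z^k = z^0` for `k < 0`.) -/
def CoordinateDelayed (τ : ℕ) (z : ℕ → PDSpace H G) (k : ℕ) (zh : PDSpace H G) : Prop :=
  (∀ i, ∃ d ≤ τ, zh.fst i = (z (k - d)).fst i) ∧
  (∀ j, ∃ d ≤ τ, zh.snd j = (z (k - d)).snd j)

/-- The inconsistent-read model: `zh = z^k + ∑_{d ∈ J} (z^d - z^{d+1})` for some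
`J ⊆ {k - 1, …, k - τ}`. -/
def InconsistentRead (τ : ℕ) (z : ℕ → PDSpace H G) (k : ℕ) (zh : PDSpace H G) : Prop :=
  ∃ J : Finset ℕ, (∀ d ∈ J, d < k ∧ k ≤ d + τ) ∧ zh = z k + ∑ d ∈ J, (z d - z (d + 1))

/-- The vector supported on the coordinate `i`, where it agrees with `w`.  The coordinates are
`x_1, …, x_m` (`Sum.inl`) and `s_1, …, s_p` (`Sum.inr`). -/
def coordPart (i : Fin m ⊕ Fin p) (w : PDSpace H G) : PDSpace H G :=
  match i with
  | .inl a => WithLp.toLp 2 (PiLp.single 2 a (w.fst a), 0)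
  | .inr b => WithLp.toLp 2 (0, PiLp.single 2 b (w.snd b))

/-- One update of coordinate `i` in the algorithm with `m + p` non-overlapping coordinates:
`z_i ← z_i - ηₖ / ((m + p) q_i) (zh_i - (T zh)_i)`. -/
def coordUpdate (T : PDSpace H G → PDSpace H G) (q : Fin m ⊕ Fin p → ℝ) (ηk : ℝ)
    (i : Fin m ⊕ Fin p) (z zh : PDSpace H G) : PDSpace H G :=
  z - (ηk / (((m : ℝ) + p) * q i)) • coordPart i (zh - T zh)

/-- The block `(Aᵀ)_{i,j} : G_j → H_i` of the adjoint. -/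
def adjBlock [∀ i, CompleteSpace (H i)] [∀ j, CompleteSpace (G j)]
    (A : PiLp 2 H →L[ℝ] PiLp 2 G) (i : Fin m) (j : Fin p) (u : G j) : H i :=
  (A.adjoint (PiLp.single 2 j u)) i

open Classical in
/-- `𝕁(i) = {j : (Aᵀ)_{i,j} ≠ 0}`. -/
def dualNbrs [∀ i, CompleteSpace (H i)] [∀ j, CompleteSpace (G j)]
    (A : PiLp 2 H →L[ℝ] PiLp 2 G) (i : Fin m) : Finset (Fin p) :=
  Finset.univ.filter fun j => ∃ u, adjBlock A i j u ≠ 0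

open Classical in
/-- `𝕀(j) = {i : (Aᵀ)_{i,j} ≠ 0}`. -/
def primalNbrs [∀ i, CompleteSpace (H i)] [∀ j, CompleteSpace (G j)]
    (A : PiLp 2 H →L[ℝ] PiLp 2 G) (j : Fin p) : Finset (Fin m) :=
  Finset.univ.filter fun i => ∃ u, adjBlock A i j u ≠ 0

/-- One update of the overlapping block `i` (the coordinate `x_i` and all `s_j`, `j ∈ 𝕁(i)`):
with `s̃_j = prox_{γ h_j*}(ŝ_j + γ (A x̂)_j)` for `j ∈ 𝕁(i)` and
`x̃_i = prox_{η g_i}(x̂_i - η (∇_i f(x̂) + ∑_{j ∈ 𝕁(i)} (Aᵀ)_{i,j} (2 s̃_j - ŝ_j)))`, both computed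
from the cached copy `zh = (x̂, ŝ)`,
`x_i ← x_i + ηₖ / (m q_i) (x̃_i - x̂_i)`,
`s_j ← s_j + ρ_{i,j} ηₖ / (m q_i) (s̃_j - ŝ_j)` for `j ∈ 𝕁(i)`.
Here `gb i` is `g_i` and `hb j` is `h_j*`. -/
def overlapUpdate [∀ i, CompleteSpace (H i)] [∀ j, CompleteSpace (G j)]
    (f : PiLp 2 H → ℝ) (gb : ∀ i, H i → EReal) (hb : ∀ j, G j → EReal)
    (A : PiLp 2 H →L[ℝ] PiLp 2 G) (η γ : ℝ) (ρ : Fin m → Fin p → ℝ) (q : Fin m → ℝ) (ηk : ℝ)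
    (i : Fin m) (z zh : PDSpace H G) : PDSpace H G :=
  let st : ∀ j, G j := fun j => prox γ (hb j) (zh.snd j + γ • (A zh.fst) j)
  let xt : ∀ a, H a := fun a => prox η (gb a)
    (zh.fst a - η • ((gradient f zh.fst) a +
      ∑ j ∈ dualNbrs A a, adjBlock A a j ((2 : ℝ) • st j - zh.snd j)))
  WithLp.toLp 2
    (WithLp.toLp 2 fun a =>
      if a = i then z.fst a + (ηk / ((m : ℝ) * q i)) • (xt a - zh.fst a) else z.fst a,
     WithLp.toLp 2 fun j =>
      if j ∈ dualNbrs A i then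
        z.snd j + (ρ i j * ηk / ((m : ℝ) * q i)) • (st j - zh.snd j)
      else z.snd j)

/-- `z` is the sequence generated by an asynchronous block-coordinate algorithm with blocks indexed
by `ι`.  At iteration `k` the block `sel k` is drawn with distribution `q`, independently of the
history `ℱ k`, which contains everything that precedes the draw, the cached copy `zhat k` included.
The cached copy is a stale version of the memory with maximal delay `τ`, in either of the two
delay models.  Then `upd k (sel k)` is applied to `z k` and `zhat k`. -/
structure IsAsyncRun {Ω : Type*} [mΩ : MeasurableSpace Ω] (P : Measure Ω) (ℱ : Filtration ℕ mΩ)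
    {ι : Type*} [Fintype ι] [MeasurableSpace ι] (q : ι → ℝ) (τ : ℕ)
    (upd : ℕ → ι → PDSpace H G → PDSpace H G → PDSpace H G) (z₀ : PDSpace H G)
    (sel : ℕ → Ω → ι) (z zhat : ℕ → Ω → PDSpace H G) : Prop where
  q_pos : ∀ i, 0 < q i
  q_sum : ∑ i, q i = 1
  sel_measurable : ∀ k, Measurable[ℱ (k + 1)] (sel k)
  sel_law : ∀ k i, P {ω | sel k ω = i} = ENNReal.ofReal (q i)
  sel_indep : ∀ k, Indep (MeasurableSpace.comap (sel k) inferInstance) (ℱ k) P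
  read_measurable : ∀ k, StronglyMeasurable[ℱ k] (zhat k)
  read_delayed : ∀ k ω, CoordinateDelayed τ (fun l => z l ω) k (zhat k ω) ∨
    InconsistentRead τ (fun l => z l ω) k (zhat k ω)
  init : ∀ ω, z 0 ω = z₀
  step : ∀ k ω, z (k + 1) ω = upd k (sel k ω) (z k ω) (zhat k ω)

end Algorithms

/-- `z` converges, with probability one, to a random variable with values in `S`. -/
def ConvergesASInto {Ω F : Type*} [MeasurableSpace Ω] [TopologicalSpace F] (P : Measure Ω)
    (z : ℕ → Ω → F) (S : Set F) : Prop :=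
  ∃ Z : Ω → F, @Measurable Ω F _ (borel F) Z ∧ (∀ ω, Z ω ∈ S) ∧
    ∀ᵐ ω ∂P, Tendsto (fun k => z k ω) atTop (𝓝 (Z ω))

end

end AsyncPD

/-! By the resolvent description of the proximal map, the fixed points of `condatVu` are exactly the
primal-dual solutions (`condatVu_eq_self_iff`). Both algorithms then become one iteration z ← z - (s
/ (N q_i)) U_i (ẑ - T ẑ), with T = `condatVu`, where U_i multiplies each coordinate by a nonnegative
weight and the weights of a coordinate sum to 1 over the blocks. Only two consequences are used: ∑
U_i = I, so that the expected step is s/N times the residual, and ∑ ‖U_i v‖² ≤ ‖v‖². Hence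
overlapping blocks need no separate analysis.

For a fixed point z*, nonexpansiveness in the M-norm gives ‖u‖_M² ≤ 2⟨ẑ - z*, M u⟩ for u = ẑ - Tẑ
(`quadForm_residual_le`). Replacing ẑ by z costs a cross term, which Young's inequality splits into
a multiple of ‖u‖_M² and a multiple of S, the sum of the last τ squared step lengths. To pay for S,
the squared distance is augmented by the recent squared steps with weights τ, …, 1: moving on by one
iteration lowers every weight by one and so releases exactly S. With r = √κ and w = √q_min,
balancing the costs yields the condition η_max (2τ r w + r²) < N w², which is the stated threshold
(`sum_weighted_step_le`).

Adding the accumulated squared residuals, with a small factor, leaves a nonnegative supermartingale,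
which converges almost surely. Its boundedness along a path makes the residuals square summable;
therefore the steps and read errors vanish and ‖z^k - z*‖_M converges. Doing this for a countable
dense set of fixed points and applying Opial's argument (`exists_tendsto_of_tendsto_quadForm`) gives
convergence of the whole sequence.

For optimality of x, the inclusion Ax ∈ ∂h*(s) is inverted to s ∈ ∂h(Ax)
(`mem_subdiff_of_mem_subdiff_conj`), and the subgradient inequalities of f, g and h are added. -/

namespace AsyncPD

/-! ### The proximal map as the resolvent of the subdifferential. -/

section Prox

variable {E : Type*} [NormedAddCommGroup E] [InnerProductSpace ℝ E]

/-- The objective whose minimiser is the proximal point. -/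
noncomputable def proxObjective (γ : ℝ) (φ : E → EReal) (y u : E) : EReal :=
  φ u + ((1 / (2 * γ) * ‖u - y‖ ^ 2 : ℝ) : EReal)

theorem ClosedProperConvex.le_segment {φ : E → EReal} (hφ : ClosedProperConvex φ) {x y : E}
    {a b t : ℝ} (hx : φ x ≤ a) (hy : φ y ≤ b) (h0 : 0 ≤ t) (h1 : t ≤ 1) :
    φ (x + t • (y - x)) ≤ ((a + t * (b - a) : ℝ) : EReal) := by
  have h := hφ.convex (x := (x, a)) hx (y := (y, b)) hy (a := 1 - t) (b := t)
    (by linarith) h0 (by ring)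
  simp only [Set.mem_ofPred_eq, Prod.smul_mk, Prod.mk_add_mk, smul_eq_mul] at h
  have e1 : x + t • (y - x) = (1 - t) • x + t • y := by module
  have e2 : a + t * (b - a) = (1 - t) * a + t * b := by ring
  rw [e1, e2]
  exact h

theorem ClosedProperConvex.exists_coe {φ : E → EReal} (hφ : ClosedProperConvex φ) :
    ∃ (x : E) (r : ℝ), φ x = r := by
  obtain ⟨x, hx⟩ := hφ.exists_ne_top
  exact ⟨x, (φ x).toReal, (EReal.coe_toReal hx (hφ.ne_bot x)).symm⟩

/-- Lower semicontinuity gives a minimum c on the unit ball around a point of the domain. Outside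
the ball, convexity on the segment from the centre to u, read at its point on the unit sphere,
bounds the descent by a slope r - c. No separating hyperplane is needed. -/
theorem ClosedProperConvex.exists_norm_minorant [FiniteDimensional ℝ E] {φ : E → EReal}
    (hφ : ClosedProperConvex φ) : ∃ (x₀ : E) (c b : ℝ), 0 ≤ b ∧
      ∀ u, ((c - b * ‖u - x₀‖ : ℝ) : EReal) ≤ φ u := by
  obtain ⟨x₀, r, hr⟩ := hφ.exists_coe
  obtain ⟨x₁, -, hx₁⟩ := LowerSemicontinuousOn.exists_isMinOn (f := φ)
    (s := Metric.closedBall x₀ 1) ⟨x₀, by simp⟩ (isCompact_closedBall x₀ 1)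
    (hφ.closed.lowerSemicontinuousOn _)
  have hx₁' : ∀ u, ‖u - x₀‖ ≤ 1 → φ x₁ ≤ φ u := fun u hu =>
    hx₁ (by simpa [dist_eq_norm] using hu)
  have h10 : φ x₁ ≤ r := hr ▸ hx₁' x₀ (by simp)
  obtain ⟨c, hc⟩ : ∃ c : ℝ, φ x₁ = c :=
    ⟨(φ x₁).toReal, (EReal.coe_toReal (ne_top_of_le_ne_top (EReal.coe_ne_top r) h10)
      (hφ.ne_bot x₁)).symm⟩
  rw [hc] at h10 hx₁'
  have hcr : c ≤ r := EReal.coe_le_coe_iff.1 h10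
  refine ⟨x₀, c, r - c, by linarith, fun u => ?_⟩
  by_cases hu : ‖u - x₀‖ ≤ 1
  · refine le_trans (EReal.coe_le_coe_iff.2 ?_) (hx₁' u hu)
    nlinarith [norm_nonneg (u - x₀)]
  by_cases htop : φ u = ⊤
  · simp [htop]
  obtain ⟨a, ha⟩ : ∃ a : ℝ, φ u = a :=
    ⟨(φ u).toReal, (EReal.coe_toReal htop (hφ.ne_bot u)).symm⟩
  push Not at hu
  set d := ‖u - x₀‖ with hd
  have hd0 : 0 < d := by linarith
  have h1 := hφ.le_segment hr.le ha.le (inv_nonneg.2 hd0.le) (inv_le_one_of_one_le₀ hu.le)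
  have h2 := hx₁' (x₀ + d⁻¹ • (u - x₀)) (by
    rw [add_sub_cancel_left, norm_smul, norm_inv, Real.norm_of_nonneg hd0.le, ← hd,
      inv_mul_cancel₀ hd0.ne'])
  have h3 : c ≤ r + d⁻¹ * (a - r) := EReal.coe_le_coe_iff.1 (h2.trans h1)
  rw [ha, EReal.coe_le_coe_iff]
  have h4 : d * c ≤ d * r + (a - r) := by
    calc d * c ≤ d * (r + d⁻¹ * (a - r)) := by gcongr
      _ = d * r + (a - r) := by field_simp
  nlinarith

theorem ClosedProperConvex.exists_isMinOn_proxObjective [FiniteDimensional ℝ E] {φ : E → EReal}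
    (hφ : ClosedProperConvex φ) {γ : ℝ} (hγ : 0 < γ) (y : E) :
    ∃ x, IsMinOn (proxObjective γ φ y) Set.univ x := by
  obtain ⟨x₀, c, b, hb, hmin⟩ := hφ.exists_norm_minorant
  obtain ⟨x₁, r, hr⟩ := hφ.exists_coe
  set K : ℝ := r + 1 / (2 * γ) * ‖x₁ - y‖ ^ 2 with hK
  have hK' : proxObjective γ φ y x₁ = (K : EReal) := by
    rw [proxObjective, hr, ← EReal.coe_add]
  -- The first entry puts x₁ in the ball. Beyond the second the quadratic exceeds (b + 1)t, and
  -- beyond the third the surplus t lifts the objective above K.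
  set R : ℝ := max (‖x₁ - y‖) (max (2 * γ * (b + 1)) (K - c + b * ‖y - x₀‖)) with hR
  have hlsc : LowerSemicontinuous (proxObjective γ φ y) := by
    have hq : Continuous fun u : E => ((1 / (2 * γ) * ‖u - y‖ ^ 2 : ℝ) : EReal) :=
      continuous_coe_real_ereal.comp (by fun_prop)
    exact hφ.closed.add' hq.lowerSemicontinuous fun x =>
      EReal.continuousAt_add (Or.inr (EReal.coe_ne_bot _)) (Or.inr (EReal.coe_ne_top _))
  obtain ⟨x, -, hx⟩ := LowerSemicontinuousOn.exists_isMinOn (f := proxObjective γ φ y)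
    (s := Metric.closedBall y R) ⟨x₁, by simp [dist_eq_norm, hR]⟩ (isCompact_closedBall y R)
    (hlsc.lowerSemicontinuousOn _)
  refine ⟨x, fun u _ => ?_⟩
  by_cases hu : ‖u - y‖ ≤ R
  · exact hx (by simpa [dist_eq_norm] using hu)
  have hxx : proxObjective γ φ y x ≤ K := hK' ▸ hx (by simp [dist_eq_norm, hR])
  refine hxx.trans ?_
  have h1 : ((c - b * ‖u - x₀‖ : ℝ) : EReal) + ((1 / (2 * γ) * ‖u - y‖ ^ 2 : ℝ) : EReal)
      ≤ proxObjective γ φ y u := add_le_add_left (hmin u) _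
  refine le_trans ?_ h1
  rw [← EReal.coe_add, EReal.coe_le_coe_iff]
  push Not at hu
  set t := ‖u - y‖ with ht
  have h2 : 2 * γ * (b + 1) ≤ t :=
    ((le_max_left _ _).trans (le_max_right _ _)).trans hu.le
  have h3 : K - c + b * ‖y - x₀‖ ≤ t :=
    ((le_max_right _ _).trans (le_max_right _ _)).trans hu.le
  have h4 : ‖u - x₀‖ ≤ t + ‖y - x₀‖ := norm_sub_le_norm_sub_add_norm_sub _ _ _
  have h5 : b * ‖u - x₀‖ ≤ b * t + b * ‖y - x₀‖ := by nlinarith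
  have h6 : (b + 1) * t ≤ 1 / (2 * γ) * t ^ 2 := by
    have : b + 1 ≤ 1 / (2 * γ) * t := by
      rw [one_div, inv_mul_eq_div, le_div_iff₀ (by positivity)]; linarith
    nlinarith [norm_nonneg (u - y)]
  nlinarith

theorem quadratic_expand {γ : ℝ} (hγ : 0 < γ) (x u y : E) :
    1 / (2 * γ) * ‖u - y‖ ^ 2 = 1 / (2 * γ) * ‖x - y‖ ^ 2
      - inner ℝ ((1 / γ) • (y - x)) (u - x) + 1 / (2 * γ) * ‖u - x‖ ^ 2 := by
  have h : u - y = (u - x) + (x - y) := by abel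
  rw [h, norm_add_sq_real, ← neg_sub x y, smul_neg, inner_neg_left, real_inner_smul_left,
    real_inner_comm (u - x) (x - y)]
  field_simp
  ring

theorem subdiff_coe_le {φ : E → EReal} {x v u : E} (hv : v ∈ subdiff φ x) {r : ℝ}
    (hr : φ x = r) : ((r + inner ℝ v (u - x) : ℝ) : EReal) ≤ φ u := by
  have := hv u
  rwa [hr, ← EReal.coe_add] at this

theorem subdiff_exists_coe {φ : E → EReal} (hφ : ClosedProperConvex φ) {x v : E}
    (hv : v ∈ subdiff φ x) : ∃ r : ℝ, φ x = r := by
  obtain ⟨y, b, hb⟩ := hφ.exists_coe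
  have h := hv y
  have hne : φ x ≠ ⊤ := by
    intro htop
    rw [htop, hb, EReal.top_add_coe] at h
    exact absurd h (by simp)
  exact ⟨(φ x).toReal, (EReal.coe_toReal hne (hφ.ne_bot x)).symm⟩

theorem proxObjective_ge_of_mem_subdiff {φ : E → EReal} {γ : ℝ} (hγ : 0 < γ) {x y : E} {r : ℝ}
    (hr : φ x = r) (hv : (1 / γ) • (y - x) ∈ subdiff φ x) (u : E) :
    proxObjective γ φ y x + ((1 / (2 * γ) * ‖u - x‖ ^ 2 : ℝ) : EReal)
      ≤ proxObjective γ φ y u := by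
  have h := subdiff_coe_le (u := u) hv hr
  calc proxObjective γ φ y x + ((1 / (2 * γ) * ‖u - x‖ ^ 2 : ℝ) : EReal)
      = ((r + inner ℝ ((1 / γ) • (y - x)) (u - x) : ℝ) : EReal)
        + ((1 / (2 * γ) * ‖u - y‖ ^ 2 : ℝ) : EReal) := by
        rw [proxObjective, hr, quadratic_expand hγ x u y]
        norm_cast
        ring
    _ ≤ proxObjective γ φ y u := add_le_add_left h _

/-- The subgradient inequality plus the quadratic gives growth ‖u - x‖² / (2γ) around x, hence a
unique minimiser. Convexity of φ is not needed, so this applies to separable components about which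
nothing is known individually. -/
theorem prox_eq_of_mem_subdiff_of_coe {φ : E → EReal} {γ : ℝ} (hγ : 0 < γ) {x y : E} {r : ℝ}
    (hr : φ x = r) (hv : (1 / γ) • (y - x) ∈ subdiff φ x) : prox γ φ y = x := by
  have hge := proxObjective_ge_of_mem_subdiff hγ hr hv
  have hx : IsMinOn (proxObjective γ φ y) Set.univ x := fun u _ => by
    refine le_trans ?_ (hge u)
    refine le_add_of_nonneg_right ?_
    exact_mod_cast (by positivity : (0 : ℝ) ≤ 1 / (2 * γ) * ‖u - x‖ ^ 2)
  have hp : IsMinOn (proxObjective γ φ y) Set.univ (prox γ φ y) :=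
    Classical.epsilon_spec (p := fun x => IsMinOn (proxObjective γ φ y) Set.univ x) ⟨x, hx⟩
  have h1 := (hge (prox γ φ y)).trans (hp (Set.mem_univ x))
  rw [proxObjective, hr] at h1
  have h2 : 1 / (2 * γ) * ‖prox γ φ y - x‖ ^ 2 ≤ 0 := by
    norm_cast at h1
    linarith
  have h3 : ‖prox γ φ y - x‖ ^ 2 ≤ 0 := by
    by_contra hcon
    push Not at hcon
    have : 0 < 1 / (2 * γ) * ‖prox γ φ y - x‖ ^ 2 := by positivity
    linarith
  have h4 : ‖prox γ φ y - x‖ = 0 := by nlinarith [norm_nonneg (prox γ φ y - x)]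
  exact sub_eq_zero.1 (norm_eq_zero.1 h4)

theorem nonpos_of_forall_le_mul {X C : ℝ} (h : ∀ t : ℝ, 0 < t → t ≤ 1 → X ≤ t * C) : X ≤ 0 := by
  by_contra hX
  push Not at hX
  have hC : 0 < C := by have := h 1 one_pos le_rfl; linarith
  have ht := h (min 1 (X / (2 * C))) (by positivity) (min_le_left _ _)
  have : min 1 (X / (2 * C)) * C ≤ X / (2 * C) * C := by gcongr; exact min_le_right _ _
  have e : X / (2 * C) * C = X / 2 := by field_simp
  linarith

/-- Compare x with x + t(u - x), divide by t and let t tend to 0: the quadratic remainder is of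
order t. -/
theorem mem_subdiff_of_isMinOn {φ : E → EReal} (hφ : ClosedProperConvex φ) {γ : ℝ} (hγ : 0 < γ)
    {x y : E} (hx : IsMinOn (proxObjective γ φ y) Set.univ x) :
    (1 / γ) • (y - x) ∈ subdiff φ x := by
  obtain ⟨x₀, r₀, hr₀⟩ := hφ.exists_coe
  have hne : φ x ≠ ⊤ := by
    intro htop
    have h : proxObjective γ φ y x ≤ proxObjective γ φ y x₀ := hx (Set.mem_univ x₀)
    rw [proxObjective, proxObjective, htop, hr₀, EReal.top_add_coe, ← EReal.coe_add] at h
    exact absurd h (not_le.2 (EReal.coe_lt_top _))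
  obtain ⟨r, hr⟩ : ∃ r : ℝ, φ x = r := ⟨_, (EReal.coe_toReal hne (hφ.ne_bot x)).symm⟩
  intro u
  by_cases htop : φ u = ⊤
  · simp [htop]
  obtain ⟨a, ha⟩ : ∃ a : ℝ, φ u = a := ⟨_, (EReal.coe_toReal htop (hφ.ne_bot u)).symm⟩
  rw [hr, ha, ← EReal.coe_add, EReal.coe_le_coe_iff]
  have key : r + inner ℝ ((1 / γ) • (y - x)) (u - x) - a ≤ 0 := by
    refine nonpos_of_forall_le_mul (C := 1 / (2 * γ) * ‖u - x‖ ^ 2) fun t ht0 ht1 => ?_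
    have h1 := hφ.le_segment hr.le ha.le ht0.le ht1
    have h2 : proxObjective γ φ y x ≤ proxObjective γ φ y (x + t • (u - x)) :=
      hx (Set.mem_univ _)
    have h3 := h2.trans (add_le_add_left h1 _)
    rw [proxObjective, hr, quadratic_expand hγ x (x + t • (u - x)) y, add_sub_cancel_left,
      inner_smul_right, norm_smul, Real.norm_of_nonneg ht0.le] at h3
    norm_cast at h3
    have h4 : t * (r + inner ℝ ((1 / γ) • (y - x)) (u - x) - a)
        ≤ t * (t * (1 / (2 * γ) * ‖u - x‖ ^ 2)) := by linarith
    exact le_of_mul_le_mul_left h4 ht0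
  linarith

theorem mem_subdiff_prox [FiniteDimensional ℝ E] {φ : E → EReal} (hφ : ClosedProperConvex φ)
    {γ : ℝ} (hγ : 0 < γ) (y : E) : (1 / γ) • (y - prox γ φ y) ∈ subdiff φ (prox γ φ y) :=
  mem_subdiff_of_isMinOn hφ hγ
    (Classical.epsilon_spec (p := fun x => IsMinOn (proxObjective γ φ y) Set.univ x)
      (hφ.exists_isMinOn_proxObjective hγ y))

theorem prox_eq_iff [FiniteDimensional ℝ E] {φ : E → EReal} (hφ : ClosedProperConvex φ)
    {γ : ℝ} (hγ : 0 < γ) {x y : E} : prox γ φ y = x ↔ (1 / γ) • (y - x) ∈ subdiff φ x := by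
  constructor
  · rintro rfl
    exact mem_subdiff_prox hφ hγ y
  · intro h
    obtain ⟨r, hr⟩ := subdiff_exists_coe hφ h
    exact prox_eq_of_mem_subdiff_of_coe hγ hr h

end Prox

/-! ### Subgradients of the conjugate. -/

section Conjugate

variable {E : Type*} [NormedAddCommGroup E] [InnerProductSpace ℝ E]

theorem conj_eq_of_mem_subdiff {h : E → EReal} {u v : E} {r : ℝ} (hr : h u = r)
    (hv : v ∈ subdiff h u) : conj h v = ((inner ℝ v u - r : ℝ) : EReal) := by
  refine le_antisymm (iSup_le fun y => ?_) ?_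
  · have h1 := subdiff_coe_le (u := y) hv hr
    refine (EReal.sub_le_sub le_rfl h1).trans ?_
    rw [← EReal.coe_sub, EReal.coe_le_coe_iff, inner_sub_right]
    linarith
  · have : ((inner ℝ v u : ℝ) : EReal) - h u ≤ conj h v :=
      le_iSup (fun y => ((inner ℝ v y : ℝ) : EReal) - h y) u
    rwa [hr, ← EReal.coe_sub] at this

theorem mem_subdiff_conj {h : E → EReal} {u v : E} {r : ℝ} (hr : h u = r)
    (hv : v ∈ subdiff h u) : u ∈ subdiff (conj h) v := by
  intro w
  have h2 : ((inner ℝ w u : ℝ) : EReal) - h u ≤ conj h w :=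
    le_iSup (fun y => ((inner ℝ w y : ℝ) : EReal) - h y) u
  rw [conj_eq_of_mem_subdiff hr hv]
  refine le_trans ?_ h2
  rw [hr, ← EReal.coe_sub, ← EReal.coe_add, EReal.coe_le_coe_iff, inner_sub_right,
    real_inner_comm w u, real_inner_comm v u]
  linarith

/-- A subgradient of the conjugate of a closed proper convex function is a point at which the
argument is a subgradient. -/
theorem mem_subdiff_of_mem_subdiff_conj [FiniteDimensional ℝ E] {h : E → EReal}
    (hh : ClosedProperConvex h) (hc : ClosedProperConvex (conj h)) {y s : E}
    (hy : y ∈ subdiff (conj h) s) : s ∈ subdiff h y := by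
  -- By Moreau's decomposition, s + y - u ∈ ∂h(u), so u ∈ ∂h*(s + y - u). Monotonicity of ∂h*
  -- against y ∈ ∂h*(s) reads -‖y - u‖² ≥ 0, whence u = y. This bypasses the biconjugation theorem.
  set u := prox 1 h (s + y) with hu
  have h1 : s + y - u ∈ subdiff h u := by
    simpa using mem_subdiff_prox hh one_pos (s + y)
  obtain ⟨r, hr⟩ := subdiff_exists_coe hh h1
  have h2 := mem_subdiff_conj hr h1
  have hv := conj_eq_of_mem_subdiff hr h1
  obtain ⟨a, ha⟩ := subdiff_exists_coe hc hy
  have h3 := subdiff_coe_le (u := s + y - u) hy ha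
  have h4 := subdiff_coe_le (u := s) h2 hv
  rw [hv, EReal.coe_le_coe_iff] at h3
  rw [ha, EReal.coe_le_coe_iff] at h4
  have e1 : s + y - u - s = y - u := by abel
  have e2 : s - (s + y - u) = -(y - u) := by abel
  rw [e1] at h3
  rw [e2, inner_neg_right] at h4
  have h5 : inner ℝ (y - u) (y - u) ≤ (0 : ℝ) := by rw [inner_sub_left]; linarith
  have h6 : y - u = 0 := by
    rw [real_inner_self_eq_norm_sq] at h5
    exact norm_eq_zero.1 (by nlinarith [norm_nonneg (y - u)])
  have h7 : u = y := (sub_eq_zero.1 h6).symm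
  rw [h7] at h1
  simpa using h1

end Conjugate

/-! ### Separable functions and componentwise proximal maps. -/

section Separable

theorem exists_coe_of_add_eq_coe {a b : EReal} {r : ℝ} (h : a + b = r) :
    ∃ a' b' : ℝ, a = a' ∧ b = b' := by
  induction a <;> induction b <;> simp_all

variable {n : ℕ} {H : Fin n → Type*} [∀ i, NormedAddCommGroup (H i)]
  [∀ i, InnerProductSpace ℝ (H i)]

theorem inner_piLp_single (v : PiLp 2 H) (i : Fin n) (w : H i) :
    inner ℝ v (PiLp.single 2 i w) = inner ℝ (v i) w := by
  rw [PiLp.inner_apply, Finset.sum_eq_single i]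
  · simp
  · intro j _ hj
    simp [hj]
  · simp

/-- Perturb the coordinate i alone and cancel the other summands. Cancellation is legitimate because
a sum in `EReal` with a real value has real summands. -/
theorem mem_subdiff_component {φ : PiLp 2 H → EReal} {φb : ∀ i, H i → EReal}
    (hsep : ∀ x, φ x = ∑ i, φb i (x i)) {x v : PiLp 2 H} {r : ℝ} (hr : φ x = r)
    (hv : v ∈ subdiff φ x) (i : Fin n) :
    (∃ a : ℝ, φb i (x i) = a) ∧ v i ∈ subdiff (φb i) (x i) := by
  have hsplit : ∀ y, φ y = φb i (y i) + ∑ j ∈ Finset.univ.erase i, φb j (y j) := fun y => by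
    rw [hsep, Finset.add_sum_erase _ (fun j => φb j (y j)) (Finset.mem_univ i)]
  obtain ⟨a, b, ha, hb⟩ := exists_coe_of_add_eq_coe ((hsplit x).symm.trans hr)
  refine ⟨⟨a, ha⟩, fun u => ?_⟩
  have h := hv (x + PiLp.single 2 i (u - x i))
  rw [hsplit x, hsplit (x + _), add_sub_cancel_left, inner_piLp_single] at h
  have hrest : ∑ j ∈ Finset.univ.erase i, φb j ((x + PiLp.single 2 i (u - x i)) j) = b := by
    rw [← hb]
    refine Finset.sum_congr rfl fun j hj => ?_
    simp [Finset.ne_of_mem_erase hj]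
  have hi : (x + PiLp.single 2 i (u - x i)) i = u := by simp
  rw [hrest, hi, ha, hb] at h
  rw [ha]
  generalize φb i u = c at h ⊢
  induction c with
  | bot => rw [EReal.bot_add, ← EReal.coe_add, ← EReal.coe_add] at h; simp at h
  | top => exact le_top
  | coe c => norm_cast at h ⊢; linarith

theorem prox_component [∀ i, FiniteDimensional ℝ (H i)] {φ : PiLp 2 H → EReal}
    (hφ : ClosedProperConvex φ) {φb : ∀ i, H i → EReal} (hsep : ∀ x, φ x = ∑ i, φb i (x i))
    {γ : ℝ} (hγ : 0 < γ) (y : PiLp 2 H) (i : Fin n) :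
    prox γ (φb i) (y i) = prox γ φ y i := by
  have hv := mem_subdiff_prox hφ hγ y
  obtain ⟨r, hr⟩ := subdiff_exists_coe hφ hv
  obtain ⟨⟨a, ha⟩, h⟩ := mem_subdiff_component hsep hr hv i
  exact prox_eq_of_mem_subdiff_of_coe hγ ha (by simpa using h)

end Separable

/-! ### Fixed points, primal-dual solutions and minimizers. -/

section FixedPoints

variable {X Y : Type*} [NormedAddCommGroup X] [InnerProductSpace ℝ X] [CompleteSpace X]
  [NormedAddCommGroup Y] [InnerProductSpace ℝ Y] [CompleteSpace Y]

/-- At a fixed point s⁺ = s, so the extrapolation 2s⁺ - s collapses to s and the two resolvent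
equations become the two inclusions. -/
theorem condatVu_eq_self_iff [FiniteDimensional ℝ X] [FiniteDimensional ℝ Y]
    {f : X → ℝ} {g : X → EReal} {h : Y → EReal} {A : X →L[ℝ] Y} {η γ : ℝ}
    (hg : ClosedProperConvex g) (hh : ClosedProperConvex (conj h)) (hη : 0 < η) (hγ : 0 < γ)
    (z : WithLp 2 (X × Y)) :
    condatVu f g h A η γ z = z ↔ z ∈ solutionSet f g h A := by
  have hs : prox γ (conj h) (z.snd + γ • A z.fst) = z.snd ↔
      A z.fst ∈ subdiff (conj h) z.snd := by
    rw [prox_eq_iff hh hγ, add_sub_cancel_left, smul_smul, one_div_mul_cancel hγ.ne', one_smul]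
  have hx : prox η g (z.fst - η • (gradient f z.fst + A.adjoint ((2 : ℝ) • z.snd - z.snd))) =
      z.fst ↔ -(gradient f z.fst + A.adjoint z.snd) ∈ subdiff g z.fst := by
    rw [prox_eq_iff hg hη, two_smul, add_sub_cancel_right, sub_sub_cancel_left, smul_neg,
      smul_smul, one_div_mul_cancel hη.ne', one_smul]
  constructor
  · intro hz
    have h2 : prox γ (conj h) (z.snd + γ • A z.fst) = z.snd := congrArg WithLp.snd hz
    have h1 : prox η g (z.fst - η • (gradient f z.fst + A.adjoint
        ((2 : ℝ) • prox γ (conj h) (z.snd + γ • A z.fst) - z.snd))) = z.fst :=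
      congrArg WithLp.fst hz
    rw [h2] at h1
    exact ⟨hx.1 h1, hs.1 h2⟩
  · rintro ⟨h1, h2⟩
    have h2' := hs.2 h2
    have h1' := hx.2 h1
    simp only [condatVu]
    rw [h2', h1']
    rfl

theorem add_inner_gradient_le_of_convexOn {f : X → ℝ} (hf : ConvexOn ℝ Set.univ f)
    (hd : Differentiable ℝ f) (x y : X) : f x + inner ℝ (gradient f x) (y - x) ≤ f y := by
  have hg : HasGradientAt f (gradient f x) x := (hd x).hasGradientAt
  have hl : HasDerivAt (fun t : ℝ => x + t • (y - x)) (y - x) 0 := by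
    simpa using ((hasDerivAt_id (0 : ℝ)).smul_const (y - x)).const_add x
  have hder : HasDerivAt (fun t : ℝ => f (x + t • (y - x)))
      (inner ℝ (gradient f x) (y - x)) 0 := by
    have h0 : HasFDerivAt f (InnerProductSpace.toDual ℝ X (gradient f x))
        (x + (0 : ℝ) • (y - x)) := by simpa using hg.hasFDerivAt
    simpa [Function.comp_def] using h0.comp_hasDerivAt (0 : ℝ) hl
  have hc : ConvexOn ℝ Set.univ (fun t : ℝ => f (x + t • (y - x))) := by
    have := hf.comp_affineMap (AffineMap.lineMap x y : ℝ →ᵃ[ℝ] X)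
    simpa [Function.comp_def, AffineMap.lineMap_apply, add_comm] using this
  have := hc.le_slope_of_hasDerivAt (Set.mem_univ 0) (Set.mem_univ 1) one_pos hder
  simp only [slope_def_field, one_smul, zero_smul, sub_zero, div_one, add_zero,
    add_sub_cancel] at this
  linarith

theorem isMinOn_of_mem_solutionSet [FiniteDimensional ℝ Y]
    {f : X → ℝ} {g : X → EReal} {h : Y → EReal} {A : X →L[ℝ] Y}
    (hf : ConvexOn ℝ Set.univ f) (hd : Differentiable ℝ f) (hg : ClosedProperConvex g)
    (hc : ClosedProperConvex (conj h)) (hh : ClosedProperConvex h) {z : WithLp 2 (X × Y)}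
    (hz : z ∈ solutionSet f g h A) :
    IsMinOn (fun x => (f x : EReal) + g x + h (A x)) Set.univ z.fst := by
  obtain ⟨h1, h2⟩ := hz
  have h3 := mem_subdiff_of_mem_subdiff_conj hh hc h2
  obtain ⟨a, ha⟩ := subdiff_exists_coe hg h1
  obtain ⟨b, hb⟩ := subdiff_exists_coe hh h3
  intro y _
  change (f z.fst : EReal) + g z.fst + h (A z.fst) ≤ (f y : EReal) + g y + h (A y)
  have hfy := add_inner_gradient_le_of_convexOn hf hd z.fst y
  have hgy := subdiff_coe_le (u := y) h1 ha
  have hhy := subdiff_coe_le (u := A y) h3 hb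
  rw [← map_sub, ← ContinuousLinearMap.adjoint_inner_left] at hhy
  rw [inner_neg_left, inner_add_left] at hgy
  rw [ha, hb]
  calc (f z.fst : EReal) + a + b = ((f z.fst + a + b : ℝ) : EReal) := by norm_cast
    -- In the sum of the three subgradient inequalities the linear terms ∇f, -(∇f + Aᵀs) and Aᵀs
    -- cancel.
    _ ≤ ((f y + (a + -(inner ℝ (gradient f z.fst) (y - z.fst)
          + inner ℝ (A.adjoint z.snd) (y - z.fst)))
          + (b + inner ℝ (A.adjoint z.snd) (y - z.fst)) : ℝ) : EReal) := by
        rw [EReal.coe_le_coe_iff]; linarith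
    _ ≤ (f y : EReal) + g y + h (A y) := by
        rw [EReal.coe_add, EReal.coe_add (f y)]
        gcongr

end FixedPoints

/-! ### The metric: symmetry and spectral bounds. -/

section Metric

variable {X Y : Type*} [NormedAddCommGroup X] [InnerProductSpace ℝ X] [CompleteSpace X]
  [NormedAddCommGroup Y] [InnerProductSpace ℝ Y] [CompleteSpace Y]

theorem metric_isSymmetric (A : X →L[ℝ] Y) (η γ : ℝ) : (metric A η γ).IsSymmetric := by
  intro z w
  simp only [metric, LinearMap.coe_mk, AddHom.coe_mk, WithLp.prod_inner_apply, inner_add_left,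
    inner_add_right, real_inner_smul_left, real_inner_smul_right,
    ContinuousLinearMap.adjoint_inner_left, ContinuousLinearMap.adjoint_inner_right,
    WithLp.ofLp_fst, WithLp.ofLp_snd]
  ring

end Metric

section Spectral

variable {F : Type*} [NormedAddCommGroup F] [InnerProductSpace ℝ F] [FiniteDimensional ℝ F]

/-- A positive definite symmetric operator is comparable with the identity, the ratio of the
comparison constants being the condition number. -/
theorem exists_spectral_bounds [Nontrivial F] {M : F →ₗ[ℝ] F} (hM : M.IsSymmetric)
    (hpos : PosDefOp M) : ∃ lo hi : ℝ, 0 < lo ∧ lo ≤ hi ∧ condNumber M = hi / lo ∧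
      ∀ z, lo * ‖z‖ ^ 2 ≤ inner ℝ z (M z) ∧ inner ℝ z (M z) ≤ hi * ‖z‖ ^ 2 := by
  set S : Set ℝ := {μ : ℝ | Module.End.HasEigenvalue M μ} with hS
  have hfin : S.Finite := Module.End.finite_hasEigenvalue M
  -- The extrema of the Rayleigh quotient are eigenvalues, so they lie between the extreme elements
  -- of the finite set S.
  have hsup : (⨆ x : { x : F // x ≠ 0 }, inner ℝ (M x) (x : F) / ‖(x : F)‖ ^ 2) ∈ S :=
    hM.hasEigenvalue_iSup_of_finiteDimensional
  have hinf : (⨅ x : { x : F // x ≠ 0 }, inner ℝ (M x) (x : F) / ‖(x : F)‖ ^ 2) ∈ S :=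
    hM.hasEigenvalue_iInf_of_finiteDimensional
  have hbd : ∀ x : F, |inner ℝ (M x) x / ‖x‖ ^ 2| ≤ ‖LinearMap.toContinuousLinearMap M‖ :=
    fun x => (LinearMap.toContinuousLinearMap M).rayleighQuotient_le_norm x
  have hne : S.Nonempty := ⟨_, hsup⟩
  have hlo : sInf S ∈ S := hne.csInf_mem hfin
  refine ⟨sInf S, sSup S, ?_, csInf_le_csSup hne hfin.bddBelow hfin.bddAbove, rfl,
    fun z => ?_⟩
  · obtain ⟨v, hv⟩ := Module.End.HasEigenvalue.exists_hasEigenvector hlo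
    have h1 := hpos v hv.2
    rw [hv.apply_eq_smul, real_inner_smul_right] at h1
    exact pos_of_mul_pos_left h1 real_inner_self_nonneg
  · by_cases hz : z = 0
    · simp [hz]
    have hz' : 0 < ‖z‖ ^ 2 := by positivity
    rw [real_inner_comm]
    constructor
    · rw [← le_div_iff₀ hz']
      refine (csInf_le hfin.bddBelow hinf).trans (ciInf_le (f := fun x : { x : F // x ≠ 0 } =>
        inner ℝ (M x) (x : F) / ‖(x : F)‖ ^ 2) ?_ ⟨z, hz⟩)
      exact ⟨_, by rintro _ ⟨x, rfl⟩; exact (abs_le.1 (hbd x)).1⟩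
    · rw [← div_le_iff₀ hz']
      refine le_trans (le_ciSup (f := fun x : { x : F // x ≠ 0 } =>
        inner ℝ (M x) (x : F) / ‖(x : F)‖ ^ 2) ?_ ⟨z, hz⟩) (le_csSup hfin.bddAbove hsup)
      exact ⟨_, by rintro _ ⟨x, rfl⟩; exact (abs_le.1 (hbd x)).2⟩

end Spectral

/-! ### The one-step expected descent inequality. -/

section Descent

variable {F : Type*} [NormedAddCommGroup F] [InnerProductSpace ℝ F]

/-- The quadratic form `⟨z, M z⟩`. -/
noncomputable def quadForm (M : F →ₗ[ℝ] F) (z : F) : ℝ := inner ℝ z (M z)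

theorem quadForm_nonneg {M : F →ₗ[ℝ] F} (hpos : PosDefOp M) (z : F) : 0 ≤ quadForm M z := by
  by_cases hz : z = 0
  · simp [quadForm, hz]
  · exact (hpos z hz).le

theorem quadForm_sub_smul {M : F →ₗ[ℝ] F} (hM : M.IsSymmetric) (x y : F) (t : ℝ) :
    quadForm M (x - t • y) = quadForm M x - 2 * t * inner ℝ x (M y) + t ^ 2 * quadForm M y := by
  have h : inner ℝ y (M x) = (inner ℝ x (M y) : ℝ) := by rw [real_inner_comm, hM]
  simp only [quadForm, map_sub, map_smul, inner_sub_left, inner_sub_right,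
    real_inner_smul_left, real_inner_smul_right, h]
  ring

theorem two_mul_inner_le {M : F →ₗ[ℝ] F} (hM : M.IsSymmetric) (hpos : PosDefOp M) (e u : F)
    {α : ℝ} (hα : 0 < α) :
    2 * inner ℝ e (M u) ≤ α * quadForm M e + 1 / α * quadForm M u := by
  have h := mul_nonneg hα.le (quadForm_nonneg hpos (e - (1 / α) • u))
  rw [quadForm_sub_smul hM] at h
  have e1 : α * (quadForm M e - 2 * (1 / α) * inner ℝ e (M u) + (1 / α) ^ 2 * quadForm M u)
      = α * quadForm M e + 1 / α * quadForm M u - 2 * inner ℝ e (M u) := by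
    field_simp
    ring
  linarith

theorem quadForm_le_of_nonexpansiveUnder {M : F →ₗ[ℝ] F} (hpos : PosDefOp M) {T : F → F}
    (hT : NonexpansiveUnder M T) (z w : F) : quadForm M (T z - T w) ≤ quadForm M (z - w) :=
  (Real.sqrt_le_sqrt_iff (quadForm_nonneg hpos _)).1 (hT z w)

theorem quadForm_residual_le {M : F →ₗ[ℝ] F} (hM : M.IsSymmetric) (hpos : PosDefOp M)
    {T : F → F} (hT : NonexpansiveUnder M T) {z w : F} (hw : T w = w) :
    quadForm M (z - T z) ≤ 2 * inner ℝ (z - w) (M (z - T z)) := by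
  have h := quadForm_le_of_nonexpansiveUnder hpos hT z w
  have e : T z - T w = (z - w) - (1 : ℝ) • (z - T z) := by rw [hw]; module
  rw [e, quadForm_sub_smul hM] at h
  linarith

/-- The left side is the conditional expectation of the new squared distance plus the new step
entering the history with weight τ. The term `c * S` on the right is what the ageing of the history
pays back. The choice c = lo·r·w makes the Young cost and the history cost equal, each contributing
τ·r·w to the step-size condition. -/
theorem sum_weighted_step_le {ι : Type*} [Fintype ι] {M : F →ₗ[ℝ] F} (hM : M.IsSymmetric)
    (hpos : PosDefOp M) {lo r w N ηmin ηmax s c S : ℝ} {τ : ℕ} {q : ι → ℝ}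
    (hlo : 0 < lo) (hr : 0 < r) (hw : 0 < w) (hN : 0 < N)
    (hbd : ∀ z, lo * ‖z‖ ^ 2 ≤ quadForm M z ∧ quadForm M z ≤ r ^ 2 * lo * ‖z‖ ^ 2)
    (hq : ∀ i, w ^ 2 ≤ q i) (hq1 : ∑ i, q i = 1) (hmin : 0 < ηmin) (hs : ηmin ≤ s)
    (hs' : s ≤ ηmax) (hstep : ηmax * (2 * τ * (r * w) + r ^ 2) ≤ N * w ^ 2)
    (hc : c = lo * (r * w))
    {U : ι → F →ₗ[ℝ] F} (hU : ∀ v, ∑ i, U i v = v) (hU' : ∀ v, ∑ i, ‖U i v‖ ^ 2 ≤ ‖v‖ ^ 2)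
    {T : F → F} (hT : NonexpansiveUnder M T) {zs z zh : F} (hzs : T zs = zs) (hS : 0 ≤ S)
    (hread : ‖z - zh‖ ^ 2 ≤ τ * S) :
    ∑ i, q i * (quadForm M (z - (s / (N * q i)) • U i (zh - T zh) - zs)
        + c * (τ * ‖(s / (N * q i)) • U i (zh - T zh)‖ ^ 2))
      ≤ quadForm M (z - zs) + c * S
        - ηmin / N * (1 - ηmax * (2 * τ * (r * w) + r ^ 2) / (N * w ^ 2))
          * quadForm M (zh - T zh) := by
  set u := zh - T zh with hu
  have hs0 : 0 < s := hmin.trans_le hs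
  have hmax : 0 < ηmax := hs0.trans_le hs'
  have hqi : ∀ i, 0 < q i := fun i => (by positivity : 0 < w ^ 2).trans_le (hq i)
  have hc0 : 0 < c := by rw [hc]; positivity
  have hu0 := quadForm_nonneg hpos u
  -- the contribution of the squared step lengths
  have hE : ∑ i, ‖U i u‖ ^ 2 / q i ≤ quadForm M u / (w ^ 2 * lo) := by
    calc ∑ i, ‖U i u‖ ^ 2 / q i ≤ ∑ i, ‖U i u‖ ^ 2 / w ^ 2 :=
          Finset.sum_le_sum fun i _ => div_le_div_of_nonneg_left (by positivity)
            (by positivity) (hq i)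
      _ = (∑ i, ‖U i u‖ ^ 2) / w ^ 2 := by rw [Finset.sum_div]
      _ ≤ (quadForm M u / lo) / w ^ 2 := by
          gcongr
          rw [le_div_iff₀ hlo, mul_comm]
          exact (mul_le_mul_of_nonneg_left (hU' u) hlo.le).trans (hbd u).1
      _ = quadForm M u / (w ^ 2 * lo) := by rw [div_div, mul_comm lo]
  -- expansion of the weighted sum
  have hterm : ∀ i, q i * (quadForm M (z - (s / (N * q i)) • U i u - zs)
        + c * (τ * ‖(s / (N * q i)) • U i u‖ ^ 2))
      ≤ q i * quadForm M (z - zs) - 2 * (s / N) * inner ℝ (z - zs) (M (U i u))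
        + (r ^ 2 * lo + c * τ) * (s / N) ^ 2 * (‖U i u‖ ^ 2 / q i) := by
    intro i
    have hi := hqi i
    have e : z - (s / (N * q i)) • U i u - zs = (z - zs) - (s / (N * q i)) • U i u := by abel
    rw [e, quadForm_sub_smul hM, norm_smul, mul_pow, Real.norm_eq_abs, sq_abs]
    have h1 : q i * (s / (N * q i)) = s / N := by field_simp
    have h2 : q i * (s / (N * q i)) ^ 2 = (s / N) ^ 2 / q i := by field_simp
    calc q i * (quadForm M (z - zs) - 2 * (s / (N * q i)) * inner ℝ (z - zs) (M (U i u))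
          + (s / (N * q i)) ^ 2 * quadForm M (U i u)
          + c * (τ * ((s / (N * q i)) ^ 2 * ‖U i u‖ ^ 2)))
        = q i * quadForm M (z - zs)
          - 2 * (q i * (s / (N * q i))) * inner ℝ (z - zs) (M (U i u))
          + (q i * (s / (N * q i)) ^ 2) * (quadForm M (U i u) + c * τ * ‖U i u‖ ^ 2) := by ring
      _ ≤ q i * quadForm M (z - zs)
          - 2 * (q i * (s / (N * q i))) * inner ℝ (z - zs) (M (U i u))
          + (q i * (s / (N * q i)) ^ 2)
            * (r ^ 2 * lo * ‖U i u‖ ^ 2 + c * τ * ‖U i u‖ ^ 2) := by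
          have := (hbd (U i u)).2
          gcongr
      _ = _ := by rw [h1, h2]; ring
  have hsum : ∑ i, inner ℝ (z - zs) (M (U i u)) = inner ℝ (z - zs) (M u) := by
    rw [← inner_sum, ← map_sum, hU]
  have hmain := Finset.sum_le_sum fun i (_ : i ∈ Finset.univ) => hterm i
  rw [Finset.sum_add_distrib, Finset.sum_sub_distrib, ← Finset.sum_mul, ← Finset.mul_sum,
    ← Finset.mul_sum, hsum, hq1, one_mul] at hmain
  -- the cross term
  have hres := quadForm_residual_le hM hpos hT hzs (z := zh)
  rw [← hu] at hres
  have hcross : 2 * inner ℝ (zh - z) (M u)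
      ≤ N * c / ηmax * S + ηmax * (r * τ) / (N * w) * quadForm M u := by
    have hnorm : ‖zh - z‖ ^ 2 ≤ τ * S := by rwa [norm_sub_rev]
    -- For τ = 0 the read is exact and the Young parameter below would have a zero denominator.
    rcases Nat.eq_zero_or_pos τ with h0 | h0
    · have : zh - z = 0 := by
        rw [h0, Nat.cast_zero, zero_mul] at hnorm
        exact norm_eq_zero.1 (by nlinarith [norm_nonneg (zh - z)])
      rw [this, inner_zero_left, h0]
      simp only [Nat.cast_zero, mul_zero, zero_div, zero_mul, add_zero]
      positivity
    · have hτ : (0 : ℝ) < τ := Nat.cast_pos.2 h0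
      -- This parameter gives S the coefficient N c / ηmax; multiplied by s / N it is at most c.
      have hα : 0 < N * w / (ηmax * r * τ) := by positivity
      refine (two_mul_inner_le hM hpos (zh - z) u hα).trans ?_
      have h1 : quadForm M (zh - z) ≤ r ^ 2 * lo * (τ * S) :=
        (hbd _).2.trans (by gcongr)
      have h2 : N * w / (ηmax * r * τ) * quadForm M (zh - z) ≤ N * c / ηmax * S := by
        calc N * w / (ηmax * r * τ) * quadForm M (zh - z)
            ≤ N * w / (ηmax * r * τ) * (r ^ 2 * lo * (τ * S)) := by gcongr
          _ = N * c / ηmax * S := by rw [hc]; field_simp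
      have h3 : 1 / (N * w / (ηmax * r * τ)) = ηmax * (r * τ) / (N * w) := by
        field_simp
      rw [h3]
      linarith
  have hinner : -(2 * (s / N) * inner ℝ (z - zs) (M u))
      ≤ s / N * (-quadForm M u + (N * c / ηmax * S + ηmax * (r * τ) / (N * w) * quadForm M u)) := by
    -- The residual inequality holds at the stale point, hence the split.
    have e : z - zs = (zh - zs) - (zh - z) := by abel
    have h4 : -(2 * inner ℝ (z - zs) (M u))
        ≤ -quadForm M u + (N * c / ηmax * S + ηmax * (r * τ) / (N * w) * quadForm M u) := by
      rw [e, inner_sub_left]; linarith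
    have := mul_le_mul_of_nonneg_left h4 (by positivity : 0 ≤ s / N)
    linarith
  have hS1 : s / N * (N * c / ηmax * S) ≤ c * S := by
    have : s / N * (N * c / ηmax * S) = s / ηmax * (c * S) := by field_simp
    rw [this]
    exact mul_le_of_le_one_left (by positivity) ((div_le_one hmax).2 hs')
  have hquad : (r ^ 2 * lo + c * τ) * (s / N) ^ 2 * ∑ i, ‖U i u‖ ^ 2 / q i
      ≤ s / N * (ηmax * (r ^ 2 + r * w * τ) / (N * w ^ 2)) * quadForm M u := by
    calc (r ^ 2 * lo + c * τ) * (s / N) ^ 2 * ∑ i, ‖U i u‖ ^ 2 / q i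
        ≤ (r ^ 2 * lo + c * τ) * (s / N) ^ 2 * (quadForm M u / (w ^ 2 * lo)) := by gcongr
      _ = s / N * (s * (r ^ 2 + r * w * τ) / (N * w ^ 2)) * quadForm M u := by
          rw [hc]; field_simp
      _ ≤ _ := by gcongr
  have hfin : s / N * (-quadForm M u + ηmax * (r * τ) / (N * w) * quadForm M u)
      + s / N * (ηmax * (r ^ 2 + r * w * τ) / (N * w ^ 2)) * quadForm M u
      ≤ -(ηmin / N * (1 - ηmax * (2 * τ * (r * w) + r ^ 2) / (N * w ^ 2)) * quadForm M u) := by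
    have e : s / N * (-quadForm M u + ηmax * (r * τ) / (N * w) * quadForm M u)
        + s / N * (ηmax * (r ^ 2 + r * w * τ) / (N * w ^ 2)) * quadForm M u
        = -(s / N * (1 - ηmax * (2 * τ * (r * w) + r ^ 2) / (N * w ^ 2)) * quadForm M u) := by
      field_simp
      ring
    rw [e, neg_le_neg_iff]
    have : 0 ≤ 1 - ηmax * (2 * τ * (r * w) + r ^ 2) / (N * w ^ 2) :=
      sub_nonneg.2 ((div_le_one (by positivity)).2 hstep)
    gcongr
  nlinarith

end Descent

/-! ### Bounded measurable functions, for which integrability is automatic. -/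

section BoundedMeasurable

variable {Ω : Type*} {E E' : Type*} [NormedAddCommGroup E] [NormedAddCommGroup E']

/-- Strongly measurable and bounded. -/
def BddMeas (m : MeasurableSpace Ω) (φ : Ω → E) : Prop :=
  StronglyMeasurable[m] φ ∧ ∃ C : ℝ, ∀ ω, ‖φ ω‖ ≤ C

variable {m : MeasurableSpace Ω}

theorem BddMeas.mono {m' : MeasurableSpace Ω} {φ : Ω → E} (hφ : BddMeas m φ) (h : m ≤ m') :
    BddMeas m' φ := ⟨hφ.1.mono h, hφ.2⟩

theorem BddMeas.const (x : E) : BddMeas m (fun _ : Ω => x) :=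
  ⟨stronglyMeasurable_const, ‖x‖, fun _ => le_rfl⟩

theorem BddMeas.comp [ProperSpace E] {φ : Ω → E} (hφ : BddMeas m φ) {ψ : E → E'}
    (hψ : Continuous ψ) : BddMeas m (fun ω => ψ (φ ω)) := by
  obtain ⟨h1, C, hC⟩ := hφ
  refine ⟨hψ.comp_stronglyMeasurable h1, ?_⟩
  obtain ⟨D, hD⟩ := ((isCompact_closedBall (0 : E) C).image hψ).isBounded.exists_norm_le
  exact ⟨D, fun ω => hD _ ⟨φ ω, by simpa using hC ω, rfl⟩⟩

theorem BddMeas.add {φ ψ : Ω → E} (hφ : BddMeas m φ) (hψ : BddMeas m ψ) :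
    BddMeas m (fun ω => φ ω + ψ ω) := by
  obtain ⟨h1, C, hC⟩ := hφ
  obtain ⟨h2, D, hD⟩ := hψ
  exact ⟨h1.add h2, C + D, fun ω => norm_add_le_of_le (hC ω) (hD ω)⟩

theorem BddMeas.sub {φ ψ : Ω → E} (hφ : BddMeas m φ) (hψ : BddMeas m ψ) :
    BddMeas m (fun ω => φ ω - ψ ω) := by
  obtain ⟨h1, C, hC⟩ := hφ
  obtain ⟨h2, D, hD⟩ := hψ
  exact ⟨h1.sub h2, C + D, fun ω => norm_sub_le_of_le (hC ω) (hD ω)⟩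

theorem BddMeas.sum {κ : Type*} (s : Finset κ) {φ : κ → Ω → E}
    (hφ : ∀ j ∈ s, BddMeas m (φ j)) : BddMeas m (fun ω => ∑ j ∈ s, φ j ω) := by
  classical
  induction s using Finset.induction_on with
  | empty => simpa using BddMeas.const (m := m) (0 : E)
  | insert a s ha ih =>
    simp only [Finset.sum_insert ha]
    exact (hφ a (Finset.mem_insert_self a s)).add
      (ih fun j hj => hφ j (Finset.mem_insert_of_mem hj))

theorem BddMeas.select {ι : Type*} [Fintype ι] [MeasurableSpace ι] [MeasurableSingletonClass ι]
    {sel : Ω → ι} (hsel : Measurable[m] sel) {φ : ι → Ω → E} (hφ : ∀ i, BddMeas m (φ i)) :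
    BddMeas m (fun ω => φ (sel ω) ω) := by
  classical
  choose h1 C hC using hφ
  refine ⟨?_, ∑ i, |C i|, fun ω => ?_⟩
  · have : (fun ω => φ (sel ω) ω) = fun ω => ∑ i, (sel ⁻¹' {i}).indicator (φ i) ω := by
      funext ω
      rw [Finset.sum_eq_single (sel ω)]
      · simp
      · intro j _ hj
        exact Set.indicator_of_notMem (by simpa using hj.symm) _
      · simp
    rw [this]
    exact Finset.stronglyMeasurable_fun_sum _ fun i _ =>
      (h1 i).indicator (hsel (measurableSet_singleton i))
  · exact ((hC _ ω).trans (le_abs_self _)).trans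
      (Finset.single_le_sum (f := fun i => |C i|) (fun i _ => abs_nonneg _) (Finset.mem_univ _))

theorem BddMeas.integrable {mΩ : MeasurableSpace Ω} {P : Measure Ω} [IsFiniteMeasure P]
    (hm : m ≤ mΩ) {φ : Ω → E} (hφ : BddMeas m φ) : Integrable φ P := by
  obtain ⟨h1, C, hC⟩ := hφ
  exact Integrable.of_bound (h1.mono hm).aestronglyMeasurable C (ae_of_all _ hC)

end BoundedMeasurable

/-! ### Conditional expectation over the random block and almost sure limits. -/

section Probability

variable {Ω : Type*} [mΩ : MeasurableSpace Ω] {P : Measure Ω}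

/-- Split along the events sel = i. Each branch is m-measurable and pulls out, while the indicator
of the event is independent of m and has constant conditional expectation q i. -/
theorem condExp_select [IsProbabilityMeasure P] {ι : Type*} [Fintype ι]
    [MeasurableSpace ι] [MeasurableSingletonClass ι]
    {m : MeasurableSpace Ω} (hm : m ≤ mΩ) {sel : Ω → ι} (hsel : Measurable[mΩ] sel) {q : ι → ℝ}
    (hq : ∀ i, 0 ≤ q i) (hlaw : ∀ i, P {ω | sel ω = i} = ENNReal.ofReal (q i))
    (hind : Indep (MeasurableSpace.comap sel inferInstance) m P) {φ : ι → Ω → ℝ}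
    (hφ : ∀ i, BddMeas m (φ i)) :
    P[fun ω => φ (sel ω) ω | m] =ᵐ[P] fun ω => ∑ i, q i * φ i ω := by
  classical
  set I : ι → Ω → ℝ := fun i => (sel ⁻¹' {i}).indicator fun _ => (1 : ℝ) with hI
  have hset : ∀ i, MeasurableSet[mΩ] (sel ⁻¹' {i}) := fun i => hsel (measurableSet_singleton i)
  have hIb : ∀ i, BddMeas mΩ (I i) := fun i =>
    ⟨stronglyMeasurable_const.indicator (hset i), 1, fun ω => by
      by_cases h : ω ∈ sel ⁻¹' {i}
      · simp [hI, Set.indicator_of_mem h]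
      · simp [hI, Set.indicator_of_notMem h]⟩
  have hIint : ∀ i, Integrable (I i) P := fun i => (hIb i).integrable le_rfl
  have hprod : ∀ i, Integrable (I i * φ i) P := fun i =>
    ((hφ i).integrable hm).bdd_mul (hIb i).1.aestronglyMeasurable
      (ae_of_all _ (hIb i).2.choose_spec)
  have hdecomp : (fun ω => φ (sel ω) ω) = ∑ i, I i * φ i := by
    funext ω
    rw [Finset.sum_apply, Finset.sum_eq_single (sel ω)]
    · simp [hI]
    · intro j _ hj
      have : ω ∉ sel ⁻¹' {j} := by simpa using hj.symm
      simp [hI, Set.indicator_of_notMem this]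
    · simp
  have hcond : ∀ i, P[I i * φ i | m] =ᵐ[P] fun ω => q i * φ i ω := by
    intro i
    have h1 := condExp_mul_of_stronglyMeasurable_right (μ := P) (hφ i).1 (hprod i) (hIint i)
    have h2 : P[I i | m] =ᵐ[P] fun _ => ∫ ω, I i ω ∂P := by
      refine condExp_indep_eq hsel.comap_le hm ?_ hind
      exact stronglyMeasurable_const.indicator ⟨{i}, measurableSet_singleton i, rfl⟩
    have h3 : ∫ ω, I i ω ∂P = q i := by
      simp only [hI]
      rw [integral_indicator_const _ (hset i), smul_eq_mul, mul_one, Measure.real]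
      have : P (sel ⁻¹' {i}) = ENNReal.ofReal (q i) := hlaw i
      rw [this, ENNReal.toReal_ofReal (hq i)]
    filter_upwards [h1, h2] with ω e1 e2
    rw [e1, Pi.mul_apply, e2, h3]
  rw [hdecomp]
  refine (condExp_finsetSum (fun i _ => hprod i) m).trans ?_
  have hall : ∀ᵐ ω ∂P, ∀ i, (P[I i * φ i | m]) ω = q i * φ i ω := ae_all_iff.2 hcond
  filter_upwards [hall] with ω hω
  rw [Finset.sum_apply]
  exact Finset.sum_congr rfl fun i _ => hω i

/-- A nonnegative supermartingale converges almost surely. -/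
theorem exists_ae_tendsto_of_nonneg_supermartingale [IsProbabilityMeasure P] {ℱ : Filtration ℕ mΩ} {Y : ℕ → Ω → ℝ}
    (hY : Supermartingale Y ℱ P) (h0 : ∀ k ω, 0 ≤ Y k ω) :
    ∀ᵐ ω ∂P, ∃ c, Tendsto (fun k => Y k ω) atTop (𝓝 c) := by
  -- By nonnegativity the L¹ norm is the expectation, which decreases; so -Y is an L¹-bounded
  -- submartingale.
  have hbd : ∀ k, eLpNorm ((-Y) k) 1 P ≤ ((∫ ω, Y 0 ω ∂P).toNNReal : NNReal) := by
    intro k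
    have h1 : eLpNorm ((-Y) k) 1 P = ENNReal.ofReal (∫ ω, Y k ω ∂P) := by
      rw [Pi.neg_apply, eLpNorm_neg, eLpNorm_one_eq_lintegral_enorm,
        ofReal_integral_eq_lintegral_ofReal (hY.integrable k) (ae_of_all _ (h0 k))]
      refine lintegral_congr fun ω => ?_
      rw [Real.enorm_eq_ofReal (h0 k ω)]
    have h2 : ∫ ω, Y k ω ∂P ≤ ∫ ω, Y 0 ω ∂P := by
      simpa using hY.setIntegral_le (Nat.zero_le k) (MeasurableSet.univ)
    rw [h1]
    exact ENNReal.ofReal_le_ofReal h2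
  filter_upwards [hY.neg.exists_ae_tendsto_of_bdd hbd] with ω ⟨c, hc⟩
  exact ⟨-c, by simpa using hc.neg⟩

/-- An almost surely convergent sequence of strongly measurable functions whose limits belong to a
closed set `S` converges almost surely to a random variable with values in `S`. -/
theorem convergesASInto_of_ae_tendsto {F : Type*} [NormedAddCommGroup F] {S : Set F}
    (hS : IsClosed S) (hne : S.Nonempty) {z : ℕ → Ω → F} (hz : ∀ k, StronglyMeasurable (z k))
    (hlim : ∀ᵐ ω ∂P, ∃ x ∈ S, Tendsto (fun k => z k ω) atTop (𝓝 x)) :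
    ConvergesASInto P z S := by
  classical
  let _ : MeasurableSpace F := borel F
  have : BorelSpace F := ⟨rfl⟩
  obtain ⟨x₀, hx₀⟩ := hne
  obtain ⟨Z, hZ, hZlim⟩ := exists_stronglyMeasurable_limit_of_tendsto_ae (μ := P)
    (fun k => (hz k).aestronglyMeasurable) (hlim.mono fun ω ⟨x, _, hx⟩ => ⟨x, hx⟩)
  -- The limit is altered on a null set so that it takes values in S everywhere.
  refine ⟨fun ω => if Z ω ∈ S then Z ω else x₀, ?_, fun ω => ?_, ?_⟩
  · exact Measurable.ite (hZ.measurable hS.measurableSet) hZ.measurable measurable_const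
  · by_cases h : Z ω ∈ S
    · simp [h]
    · simpa [h] using hx₀
  · filter_upwards [hlim, hZlim] with ω ⟨x, hxS, hx⟩ hω
    rw [tendsto_nhds_unique hx hω] at hxS
    simpa [hxS] using hω

end Probability

/-! ### The window of stale iterations and its weighted history. -/

/-- The iterations `d < k` that may not yet be visible to a read at iteration `k`. -/
def staleWindow (τ k : ℕ) : Finset ℕ := (Finset.range k).filter fun d => k ≤ d + τ

theorem staleWindow_eq_Ico (τ k : ℕ) : staleWindow τ k = Finset.Ico (k - τ) k := by
  ext d
  simp only [staleWindow, Finset.mem_filter, Finset.mem_range, Finset.mem_Ico]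
  omega

theorem card_staleWindow_le (τ k : ℕ) : (staleWindow τ k).card ≤ τ := by
  rw [staleWindow_eq_Ico, Nat.card_Ico]
  omega

/-- The weighted sum of the last `τ` terms of a sequence, with weights `τ, τ - 1, …, 1`. -/
noncomputable def weightedHistory (τ : ℕ) (a : ℕ → ℝ) (k : ℕ) : ℝ :=
  ∑ d ∈ Finset.range k, ((τ + d + 1 - k : ℕ) : ℝ) * a d

/-- Each positive weight drops by one, and the positive weights are exactly those of the window.
Truncated subtraction keeps older weights at 0. -/
theorem weightedHistory_succ (τ : ℕ) (a : ℕ → ℝ) (k : ℕ) :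
    weightedHistory τ a (k + 1) =
      τ * a k + (weightedHistory τ a k - ∑ d ∈ staleWindow τ k, a d) := by
  rw [weightedHistory, Finset.sum_range_succ, weightedHistory, staleWindow, Finset.sum_filter,
    ← Finset.sum_sub_distrib, add_comm]
  congr 1
  · congr 2
    omega
  · refine Finset.sum_congr rfl fun d _ => ?_
    by_cases h : k ≤ d + τ
    · rw [if_pos h]
      have : τ + d + 1 - k = (τ + d + 1 - (k + 1)) + 1 := by omega
      rw [this]
      push_cast
      ring
    · rw [if_neg h]
      have : τ + d + 1 - k = τ + d + 1 - (k + 1) := by omega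
      rw [this, sub_zero]

theorem weightedHistory_nonneg (τ : ℕ) {a : ℕ → ℝ} (ha : ∀ d, 0 ≤ a d) (k : ℕ) :
    0 ≤ weightedHistory τ a k :=
  Finset.sum_nonneg fun d _ => mul_nonneg (Nat.cast_nonneg _) (ha d)

theorem weightedHistory_le (τ : ℕ) {a : ℕ → ℝ} (ha : ∀ d, 0 ≤ a d) (k : ℕ) :
    weightedHistory τ a k ≤ τ * ∑ d ∈ staleWindow τ k, a d := by
  rw [weightedHistory, staleWindow, Finset.sum_filter, Finset.mul_sum]
  refine Finset.sum_le_sum fun d hd => ?_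
  rw [Finset.mem_range] at hd
  by_cases h : k ≤ d + τ
  · rw [if_pos h]
    have : τ + d + 1 - k ≤ τ := by omega
    exact mul_le_mul_of_nonneg_right (by exact_mod_cast this) (ha d)
  · rw [if_neg h]
    have : τ + d + 1 - k = 0 := by omega
    simp [this]

theorem tendsto_sum_staleWindow (τ : ℕ) {a : ℕ → ℝ} (ha : Summable a) :
    Tendsto (fun k => ∑ d ∈ staleWindow τ k, a d) atTop (𝓝 0) := by
  have h1 := ha.hasSum.tendsto_sum_nat
  have h2 := h1.sub (h1.comp (tendsto_sub_atTop_nat τ))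
  rw [sub_self] at h2
  refine h2.congr fun k => ?_
  rw [staleWindow_eq_Ico, Finset.sum_Ico_eq_sub _ (Nat.sub_le k τ)]
  rfl

/-! ### Opial's argument. -/

section Opial

variable {F : Type*} [NormedAddCommGroup F] [InnerProductSpace ℝ F] [FiniteDimensional ℝ F]

theorem continuous_quadForm (M : F →ₗ[ℝ] F) : Continuous (quadForm M) :=
  continuous_id.inner (LinearMap.continuous_of_finiteDimensional M)

/-- Opial's argument: a sequence with vanishing residual, whose distance to every point of a dense
subset of the fixed-point set converges, converges to a fixed point. -/
theorem exists_tendsto_of_tendsto_quadForm {M : F →ₗ[ℝ] F} (hM : M.IsSymmetric)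
    (hpos : PosDefOp M) {lo : ℝ} (hlo : 0 < lo) (hbd : ∀ z, lo * ‖z‖ ^ 2 ≤ quadForm M z)
    {T : F → F} (hT : Continuous T) {D : Set F} (hDne : D.Nonempty)
    (hD : {x | T x = x} ⊆ closure D) {z : ℕ → F}
    (hz : ∀ p ∈ D, ∃ L, Tendsto (fun k => quadForm M (z k - p)) atTop (𝓝 L))
    (hres : Tendsto (fun k => z k - T (z k)) atTop (𝓝 0)) :
    ∃ x ∈ {x | T x = x}, Tendsto z atTop (𝓝 x) := by
  have : ProperSpace F := FiniteDimensional.proper ℝ F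
  obtain ⟨p₀, hp₀⟩ := hDne
  obtain ⟨R, hR⟩ : ∃ R, ∀ k, z k ∈ Metric.closedBall p₀ R := by
    obtain ⟨L, hL⟩ := hz p₀ hp₀
    obtain ⟨B, hB⟩ := hL.bddAbove_range
    refine ⟨√(B / lo), fun k => ?_⟩
    rw [mem_closedBall_iff_norm]
    refine Real.le_sqrt_of_sq_le ?_
    rw [le_div_iff₀ hlo, mul_comm]
    exact (hbd _).trans (hB ⟨k, rfl⟩)
  obtain ⟨x, -, φ, hφ, hx⟩ := (isCompact_closedBall p₀ R).tendsto_subseq hR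
  have hfix : T x = x := by
    have h1 : Tendsto (fun k => z (φ k) - T (z (φ k))) atTop (𝓝 (x - T x)) :=
      hx.sub ((hT.tendsto x).comp hx)
    exact (sub_eq_zero.1 (tendsto_nhds_unique h1 (hres.comp hφ.tendsto_atTop))).symm
  refine ⟨x, hfix, ?_⟩
  have hlim : ∀ p ∈ D, Tendsto (fun k => quadForm M (z k - p)) atTop (𝓝 (quadForm M (x - p))) := by
    intro p hp
    obtain ⟨L, hL⟩ := hz p hp
    have h1 : Tendsto (fun k => quadForm M (z (φ k) - p)) atTop (𝓝 (quadForm M (x - p))) :=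
      ((continuous_quadForm M).tendsto _).comp (hx.sub_const p)
    rwa [tendsto_nhds_unique h1 (hL.comp hφ.tendsto_atTop)]
  rw [Metric.tendsto_atTop]
  intro ε hε
  -- The limit x need not lie in D, so it is replaced by a nearby p. The factor 4 is 2 + 2: the
  -- bound 2Q(z k - p) + 2Q(x - p), with Q = `quadForm M`, tends to 4Q(x - p).
  obtain ⟨p, hpU, hpD⟩ : ∃ p, 4 * quadForm M (x - p) < lo * ε ^ 2 ∧ p ∈ D := by
    have hopen : IsOpen {p | 4 * quadForm M (x - p) < lo * ε ^ 2} :=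
      isOpen_lt (((continuous_quadForm M).comp (continuous_const.sub continuous_id)).const_mul 4)
        continuous_const
    have hx0 : 4 * quadForm M (x - x) < lo * ε ^ 2 := by
      rw [sub_self, quadForm, inner_zero_left, mul_zero]
      positivity
    exact mem_closure_iff.1 (hD hfix) _ hopen hx0
  have h2 := ((hlim p hpD).const_mul 2).add_const (2 * quadForm M (x - p))
  have h3 : 2 * quadForm M (x - p) + 2 * quadForm M (x - p) < lo * ε ^ 2 := by linarith
  obtain ⟨K, hK⟩ := eventually_atTop.1 (h2.eventually_lt_const h3)
  refine ⟨K, fun k hk => ?_⟩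
  have h4 : quadForm M (z k - x) ≤ 2 * quadForm M (z k - p) + 2 * quadForm M (x - p) := by
    -- Adding `e1` and `e2` is the parallelogram law; `e3` discards one of its terms.
    have e1 := quadForm_sub_smul hM (z k - p) (x - p) 1
    have e2 := quadForm_sub_smul hM (z k - p) (x - p) (-1)
    have e3 := quadForm_nonneg hpos (z k - p - (-1 : ℝ) • (x - p))
    have e4 : z k - p - (1 : ℝ) • (x - p) = z k - x := by module
    rw [e4] at e1
    linarith
  have h5 : lo * ‖z k - x‖ ^ 2 < lo * ε ^ 2 := ((hbd _).trans h4).trans_lt (hK k hk)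
  rw [dist_eq_norm]
  exact lt_of_pow_lt_pow_left₀ 2 hε.le (lt_of_mul_lt_mul_left h5 hlo.le)

end Opial

/-! ### The abstract stale block iteration: pathwise bounds and measurability. -/

/-- A randomized block iteration `z ← z - (s / (N q_i)) U_i (I - T) ẑ` with stale reads `ẑ` of a
map `T` that is nonexpansive in the metric `M`. -/
structure StaleBlockIteration {F : Type*} [NormedAddCommGroup F] [InnerProductSpace ℝ F]
    {Ω : Type*} [mΩ : MeasurableSpace Ω] (P : Measure Ω) (ℱ : Filtration ℕ mΩ)
    {ι : Type*} [Fintype ι] [MeasurableSpace ι] (M : F →ₗ[ℝ] F) (T : F → F)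
    (lo r w N ηmin ηmax : ℝ) (τ : ℕ) (q : ι → ℝ) (U : ι → F →ₗ[ℝ] F) (s : ℕ → ℝ) (z₀ : F)
    (sel : ℕ → Ω → ι) (z zhat : ℕ → Ω → F) : Prop where
  symm : M.IsSymmetric
  posDef : PosDefOp M
  nonexpansive : NonexpansiveUnder M T
  lo_pos : 0 < lo
  r_pos : 0 < r
  w_pos : 0 < w
  N_pos : 0 < N
  bounds : ∀ z, lo * ‖z‖ ^ 2 ≤ quadForm M z ∧ quadForm M z ≤ r ^ 2 * lo * ‖z‖ ^ 2
  q_ge : ∀ i, w ^ 2 ≤ q i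
  q_sum : ∑ i, q i = 1
  min_pos : 0 < ηmin
  s_mem : ∀ k, s k ∈ Set.Icc ηmin ηmax
  max_lt : ηmax * (2 * τ * (r * w) + r ^ 2) < N * w ^ 2
  sum_block : ∀ v, ∑ i, U i v = v
  norm_block : ∀ v, ∑ i, ‖U i v‖ ^ 2 ≤ ‖v‖ ^ 2
  sel_measurable : ∀ k, Measurable[ℱ (k + 1)] (sel k)
  sel_law : ∀ k i, P {ω | sel k ω = i} = ENNReal.ofReal (q i)
  sel_indep : ∀ k, Indep (MeasurableSpace.comap (sel k) inferInstance) (ℱ k) P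
  read_measurable : ∀ k, StronglyMeasurable[ℱ k] (zhat k)
  read_error : ∀ k ω, ‖z k ω - zhat k ω‖ ≤ ∑ d ∈ staleWindow τ k, ‖z (d + 1) ω - z d ω‖
  init : ∀ ω, z 0 ω = z₀
  step : ∀ k ω, z (k + 1) ω =
    z k ω - (s k / (N * q (sel k ω))) • U (sel k ω) (zhat k ω - T (zhat k ω))

namespace StaleBlockIteration

variable {F : Type*} [NormedAddCommGroup F] [InnerProductSpace ℝ F]
  {Ω : Type*} [mΩ : MeasurableSpace Ω] {P : Measure Ω} {ℱ : Filtration ℕ mΩ}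
  {ι : Type*} [Fintype ι] [MeasurableSpace ι] {M : F →ₗ[ℝ] F} {T : F → F}
  {lo r w N ηmin ηmax : ℝ} {τ : ℕ} {q : ι → ℝ} {U : ι → F →ₗ[ℝ] F} {s : ℕ → ℝ} {z₀ : F}
  {sel : ℕ → Ω → ι} {z zhat : ℕ → Ω → F}

/-- Passing through the M-norm costs the square root of the condition number, here r. -/
theorem norm_map_sub_le
    (h : StaleBlockIteration P ℱ M T lo r w N ηmin ηmax τ q U s z₀ sel z zhat) (x y : F) :
    ‖T x - T y‖ ≤ r * ‖x - y‖ := by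
  have h1 := (h.bounds (T x - T y)).1.trans
    ((quadForm_le_of_nonexpansiveUnder h.posDef h.nonexpansive x y).trans (h.bounds (x - y)).2)
  have h2 : lo * ‖T x - T y‖ ^ 2 ≤ lo * (r * ‖x - y‖) ^ 2 := by
    rw [mul_pow]; linarith
  exact (pow_le_pow_iff_left₀ (norm_nonneg _) (mul_nonneg h.r_pos.le (norm_nonneg _))
    two_ne_zero).1 (le_of_mul_le_mul_left h2 h.lo_pos)

theorem continuous_map
    (h : StaleBlockIteration P ℱ M T lo r w N ηmin ηmax τ q U s z₀ sel z zhat) :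
    Continuous T :=
  (LipschitzWith.of_dist_le_mul (K := ⟨r, h.r_pos.le⟩) fun x y => by
    rw [dist_eq_norm, dist_eq_norm]; exact h.norm_map_sub_le x y).continuous

theorem q_pos (h : StaleBlockIteration P ℱ M T lo r w N ηmin ηmax τ q U s z₀ sel z zhat)
    (i : ι) : 0 < q i :=
  (pow_pos h.w_pos 2).trans_le (h.q_ge i)

theorem s_pos (h : StaleBlockIteration P ℱ M T lo r w N ηmin ηmax τ q U s z₀ sel z zhat)
    (k : ℕ) : 0 < s k :=
  h.min_pos.trans_le (h.s_mem k).1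

theorem norm_step_le
    (h : StaleBlockIteration P ℱ M T lo r w N ηmin ηmax τ q U s z₀ sel z zhat) (k : ℕ) (ω : Ω) :
    ‖z (k + 1) ω - z k ω‖ ≤ ηmax / (N * w ^ 2) * ‖zhat k ω - T (zhat k ω)‖ := by
  have hs := h.s_pos k
  have hN := h.N_pos
  have hw := h.w_pos
  have hq := h.q_pos (sel k ω)
  have hU : ‖U (sel k ω) (zhat k ω - T (zhat k ω))‖ ≤ ‖zhat k ω - T (zhat k ω)‖ :=
    (pow_le_pow_iff_left₀ (norm_nonneg _) (norm_nonneg _) two_ne_zero).1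
      ((Finset.single_le_sum (f := fun i => ‖U i (zhat k ω - T (zhat k ω))‖ ^ 2)
        (fun i _ => sq_nonneg _) (Finset.mem_univ _)).trans (h.norm_block _))
  rw [h.step, sub_sub_cancel_left, norm_neg, norm_smul, Real.norm_of_nonneg (by positivity)]
  have h1 : s k / (N * q (sel k ω)) ≤ ηmax / (N * w ^ 2) :=
    div_le_div₀ (hs.le.trans (h.s_mem k).2) (h.s_mem k).2 (by positivity)
      (mul_le_mul_of_nonneg_left (h.q_ge _) hN.le)
  exact mul_le_mul h1 hU (norm_nonneg _) (le_trans (by positivity) h1)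

/-- Cauchy–Schwarz over a window of at most τ iterations. -/
theorem norm_read_sq_le
    (h : StaleBlockIteration P ℱ M T lo r w N ηmin ηmax τ q U s z₀ sel z zhat) (k : ℕ) (ω : Ω) :
    ‖z k ω - zhat k ω‖ ^ 2 ≤ τ * ∑ d ∈ staleWindow τ k, ‖z (d + 1) ω - z d ω‖ ^ 2 := by
  calc ‖z k ω - zhat k ω‖ ^ 2
      ≤ (∑ d ∈ staleWindow τ k, ‖z (d + 1) ω - z d ω‖) ^ 2 := by
        gcongr; exact h.read_error k ω
    _ ≤ (staleWindow τ k).card * ∑ d ∈ staleWindow τ k, ‖z (d + 1) ω - z d ω‖ ^ 2 :=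
        sq_sum_le_card_mul_sum_sq
    _ ≤ _ := mul_le_mul_of_nonneg_right (Nat.cast_le.2 (card_staleWindow_le τ k))
        (Finset.sum_nonneg fun _ _ => sq_nonneg _)

variable [FiniteDimensional ℝ F]

theorem bddMeas_read_of
    (h : StaleBlockIteration P ℱ M T lo r w N ηmin ηmax τ q U s z₀ sel z zhat) (k : ℕ)
    (hz : ∀ j ≤ k, BddMeas (ℱ k) (z j)) : BddMeas (ℱ k) (zhat k) := by
  have : ProperSpace F := FiniteDimensional.proper ℝ F
  have h1 : BddMeas (ℱ k) fun ω =>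
      ‖z k ω‖ + ∑ d ∈ staleWindow τ k, ‖z (d + 1) ω - z d ω‖ := by
    refine ((hz k le_rfl).comp continuous_norm).add (BddMeas.sum _ fun d hd => ?_)
    rw [staleWindow, Finset.mem_filter, Finset.mem_range] at hd
    exact ((hz (d + 1) hd.1).sub (hz d hd.1.le)).comp continuous_norm
  obtain ⟨C, hC⟩ := h1.2
  refine ⟨h.read_measurable k, C, fun ω => ?_⟩
  have h2 : ‖zhat k ω‖ ≤ ‖z k ω‖ + ‖z k ω - zhat k ω‖ := by
    simpa using norm_sub_le (z k ω) (z k ω - zhat k ω)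
  exact (h2.trans (add_le_add_right (h.read_error k ω) _)).trans
    ((le_abs_self _).trans (hC ω))

theorem bddMeas_residual_of
    (h : StaleBlockIteration P ℱ M T lo r w N ηmin ηmax τ q U s z₀ sel z zhat) (k : ℕ)
    (hz : BddMeas (ℱ k) (zhat k)) : BddMeas (ℱ k) (fun ω => zhat k ω - T (zhat k ω)) :=
  have : ProperSpace F := FiniteDimensional.proper ℝ F
  hz.comp (continuous_id.sub h.continuous_map)

variable [MeasurableSingletonClass ι]

/-- From a deterministic start with finitely many blocks, every iterate is bounded. The induction
carries all earlier iterates because the stale read depends on them. -/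
theorem bddMeas_iterate
    (h : StaleBlockIteration P ℱ M T lo r w N ηmin ηmax τ q U s z₀ sel z zhat) (k : ℕ) :
    BddMeas (ℱ k) (z k) := by
  have : ProperSpace F := FiniteDimensional.proper ℝ F
  suffices ∀ j ≤ k, BddMeas (ℱ j) (z j) from this k le_rfl
  induction k with
  | zero =>
    intro j hj
    obtain rfl : j = 0 := by omega
    have : z 0 = fun _ => z₀ := funext h.init
    rw [this]
    exact BddMeas.const z₀
  | succ k ih =>
    intro j hj
    rcases Nat.lt_or_ge j (k + 1) with hlt | hge
    · exact ih j (by omega)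
    obtain rfl : j = k + 1 := by omega
    have hle : ℱ k ≤ ℱ (k + 1) := ℱ.mono (Nat.le_succ k)
    have hread := h.bddMeas_residual_of k
      (h.bddMeas_read_of k fun j hj => (ih j hj).mono (ℱ.mono hj))
    have hz : z (k + 1) = _ := funext (h.step k)
    rw [hz]
    refine BddMeas.select (φ := fun i ω => z k ω - (s k / (N * q i)) •
      U i (zhat k ω - T (zhat k ω))) (h.sel_measurable k) fun i => ?_
    exact ((ih k le_rfl).sub (hread.comp
      ((LinearMap.continuous_of_finiteDimensional (U i)).const_smul _))).mono hle

theorem bddMeas_residual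
    (h : StaleBlockIteration P ℱ M T lo r w N ηmin ηmax τ q U s z₀ sel z zhat) (k : ℕ) :
    BddMeas (ℱ k) (fun ω => zhat k ω - T (zhat k ω)) :=
  h.bddMeas_residual_of k
    (h.bddMeas_read_of k fun j hj => (h.bddMeas_iterate j).mono (ℱ.mono hj))

end StaleBlockIteration

/-! ### The Lyapunov supermartingale and almost sure convergence. -/

namespace StaleBlockIteration

variable {F : Type*} [NormedAddCommGroup F] [InnerProductSpace ℝ F]
  {Ω : Type*} [mΩ : MeasurableSpace Ω] {P : Measure Ω} {ℱ : Filtration ℕ mΩ}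
  {ι : Type*} [Fintype ι] [MeasurableSpace ι] {M : F →ₗ[ℝ] F} {T : F → F}
  {lo r w N ηmin ηmax : ℝ} {τ : ℕ} {q : ι → ℝ} {U : ι → F →ₗ[ℝ] F} {s : ℕ → ℝ} {z₀ : F}
  {sel : ℕ → Ω → ι} {z zhat : ℕ → Ω → F}

/-- The squared distance to the point `zs`, plus the weighted recent step lengths, plus `δ` times
the accumulated squared residuals. -/
noncomputable def lyapunov (M : F →ₗ[ℝ] F) (T : F → F) (c δ : ℝ) (τ : ℕ)
    (z zhat : ℕ → Ω → F) (zs : F) (k : ℕ) (ω : Ω) : ℝ :=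
  quadForm M (z k ω - zs) + c * weightedHistory τ (fun d => ‖z (d + 1) ω - z d ω‖ ^ 2) k
    + δ * ∑ l ∈ Finset.range k, quadForm M (zhat l ω - T (zhat l ω))

/-- The value of the Lyapunov function at iteration `k + 1` if block `i` is updated. -/
noncomputable def lyapunovNext (M : F →ₗ[ℝ] F) (T : F → F) (c δ N : ℝ) (τ : ℕ) (q : ι → ℝ)
    (U : ι → F →ₗ[ℝ] F) (s : ℕ → ℝ) (z zhat : ℕ → Ω → F) (zs : F) (k : ℕ) (i : ι) (ω : Ω) : ℝ :=
  (quadForm M (z k ω - (s k / (N * q i)) • U i (zhat k ω - T (zhat k ω)) - zs)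
      + c * (τ * ‖(s k / (N * q i)) • U i (zhat k ω - T (zhat k ω))‖ ^ 2))
    + (c * (weightedHistory τ (fun d => ‖z (d + 1) ω - z d ω‖ ^ 2) k
        - ∑ d ∈ staleWindow τ k, ‖z (d + 1) ω - z d ω‖ ^ 2)
      + δ * ∑ l ∈ Finset.range (k + 1), quadForm M (zhat l ω - T (zhat l ω)))

theorem lyapunov_succ
    (h : StaleBlockIteration P ℱ M T lo r w N ηmin ηmax τ q U s z₀ sel z zhat) (c δ : ℝ) (zs : F)
    (k : ℕ) (ω : Ω) : lyapunov M T c δ τ z zhat zs (k + 1) ω =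
      lyapunovNext M T c δ N τ q U s z zhat zs k (sel k ω) ω := by
  have hstep : z (k + 1) ω - z k ω =
      -((s k / (N * q (sel k ω))) • U (sel k ω) (zhat k ω - T (zhat k ω))) := by
    rw [h.step]; abel
  rw [lyapunov, lyapunovNext, weightedHistory_succ, hstep, norm_neg, h.step]
  ring

theorem lyapunov_nonneg
    (h : StaleBlockIteration P ℱ M T lo r w N ηmin ηmax τ q U s z₀ sel z zhat) {c δ : ℝ}
    (hc : 0 ≤ c) (hδ : 0 ≤ δ) (zs : F) (k : ℕ) (ω : Ω) :
    0 ≤ lyapunov M T c δ τ z zhat zs k ω :=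
  add_nonneg (add_nonneg (quadForm_nonneg h.posDef _)
    (mul_nonneg hc (weightedHistory_nonneg τ (fun _ => sq_nonneg _) k)))
    (mul_nonneg hδ (Finset.sum_nonneg fun _ _ => quadForm_nonneg h.posDef _))

/-- The contraction constant of the iteration. -/
noncomputable def decrease (r w N ηmin ηmax : ℝ) (τ : ℕ) : ℝ :=
  ηmin / N * (1 - ηmax * (2 * τ * (r * w) + r ^ 2) / (N * w ^ 2))

theorem decrease_pos
    (h : StaleBlockIteration P ℱ M T lo r w N ηmin ηmax τ q U s z₀ sel z zhat) :
    0 < decrease r w N ηmin ηmax τ := by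
  have hN := h.N_pos
  have hw := h.w_pos
  exact mul_pos (div_pos h.min_pos hN)
    (sub_pos.2 ((div_lt_one (by positivity)).2 h.max_lt))

/-- The amount released by the ageing history cancels the `c * S` of `sum_weighted_step_le`, and the
guaranteed decrease equals the residual newly added to the accumulated sum. -/
theorem sum_lyapunovNext_le
    (h : StaleBlockIteration P ℱ M T lo r w N ηmin ηmax τ q U s z₀ sel z zhat) {zs : F}
    (hzs : T zs = zs) (k : ℕ) (ω : Ω) :
    ∑ i, q i * lyapunovNext M T (lo * (r * w)) (decrease r w N ηmin ηmax τ) N τ q U s z zhat zs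
        k i ω
      ≤ lyapunov M T (lo * (r * w)) (decrease r w N ηmin ηmax τ) τ z zhat zs k ω := by
  have h1 := sum_weighted_step_le h.symm h.posDef h.lo_pos h.r_pos h.w_pos h.N_pos h.bounds
    h.q_ge h.q_sum h.min_pos (h.s_mem k).1 (h.s_mem k).2 h.max_lt.le rfl h.sum_block h.norm_block
    h.nonexpansive hzs (Finset.sum_nonneg fun d _ => sq_nonneg _) (h.norm_read_sq_le k ω)
  simp only [lyapunovNext, mul_add (q _) (_ + _) (_ + _)]
  rw [Finset.sum_add_distrib, ← Finset.sum_mul, h.q_sum, one_mul, lyapunov,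
    Finset.sum_range_succ]
  rw [← decrease] at h1
  linarith

/-- This part is deterministic. Boundedness of the Lyapunov values makes the residuals summable,
which makes the squared steps summable and the history vanish. Subtracting these parts leaves the
convergent distance. Since read errors vanish too and T is Lipschitz, the residual passes from the
stale point to the iterate. -/
theorem tendsto_of_tendsto_lyapunov
    (h : StaleBlockIteration P ℱ M T lo r w N ηmin ηmax τ q U s z₀ sel z zhat) {zs : F} {ω : Ω}
    {c δ L : ℝ} (hc : 0 < c) (hδ : 0 < δ)
    (hL : Tendsto (fun k => lyapunov M T c δ τ z zhat zs k ω) atTop (𝓝 L)) :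
    (∃ L', Tendsto (fun k => quadForm M (z k ω - zs)) atTop (𝓝 L')) ∧
      Tendsto (fun k => z k ω - T (z k ω)) atTop (𝓝 0) := by
  have hlo := h.lo_pos
  have hr := h.r_pos
  set u : ℕ → F := fun k => zhat k ω - T (zhat k ω) with hu
  set a : ℕ → ℝ := fun d => ‖z (d + 1) ω - z d ω‖ ^ 2 with ha
  have ha0 : ∀ d, 0 ≤ a d := fun d => sq_nonneg _
  obtain ⟨B, hB⟩ := hL.bddAbove_range
  have hsumm : Summable fun l => quadForm M (u l) := by
    refine summable_of_sum_range_le (c := B / δ) (fun l => quadForm_nonneg h.posDef _)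
      fun k => ?_
    rw [le_div_iff₀ hδ, mul_comm]
    refine le_trans ?_ (hB ⟨k, rfl⟩)
    have h1 := quadForm_nonneg h.posDef (z k ω - zs)
    have h2 := mul_nonneg hc.le (weightedHistory_nonneg τ ha0 k)
    change δ * _ ≤ quadForm M (z k ω - zs) + c * weightedHistory τ a k + δ * _
    linarith
  have hu2 : Summable fun l => ‖u l‖ ^ 2 :=
    (hsumm.mul_left lo⁻¹).of_nonneg_of_le (fun l => sq_nonneg _) fun l => by
      rw [inv_mul_eq_div, le_div_iff₀ hlo, mul_comm]
      exact (h.bounds (u l)).1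
  have hasum : Summable a :=
    (hu2.mul_left ((ηmax / (N * w ^ 2)) ^ 2)).of_nonneg_of_le ha0 fun d => by
      rw [← mul_pow]
      exact pow_le_pow_left₀ (norm_nonneg _) (h.norm_step_le d ω) 2
  have hwin : Tendsto (fun k => τ * ∑ d ∈ staleWindow τ k, a d) atTop (𝓝 0) := by
    simpa using (tendsto_sum_staleWindow τ hasum).const_mul (τ : ℝ)
  have hhist : Tendsto (fun k => weightedHistory τ a k) atTop (𝓝 0) :=
    squeeze_zero (weightedHistory_nonneg τ ha0) (weightedHistory_le τ ha0) hwin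
  constructor
  · have h1 := (hL.sub (hhist.const_mul c)).sub (hsumm.hasSum.tendsto_sum_nat.const_mul δ)
    refine ⟨_, h1.congr fun k => ?_⟩
    change quadForm M (z k ω - zs) + c * weightedHistory τ a k
      + δ * ∑ l ∈ Finset.range k, quadForm M (u l) - c * weightedHistory τ a k
      - δ * ∑ l ∈ Finset.range k, quadForm M (u l) = quadForm M (z k ω - zs)
    ring
  · have hun : Tendsto (fun k => ‖u k‖) atTop (𝓝 0) := by
      simpa [Function.comp_def, Real.sqrt_sq] using (Real.continuous_sqrt.tendsto 0).comp hu2.tendsto_atTop_zero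
    have hread : Tendsto (fun k => ‖z k ω - zhat k ω‖) atTop (𝓝 0) := by
      have h2 : Tendsto (fun k => ‖z k ω - zhat k ω‖ ^ 2) atTop (𝓝 0) :=
        squeeze_zero (fun _ => sq_nonneg _) (fun k => h.norm_read_sq_le k ω) hwin
      simpa [Function.comp_def, Real.sqrt_sq] using (Real.continuous_sqrt.tendsto 0).comp h2
    have h3 : Tendsto (fun k => ‖u k‖ + (1 + r) * ‖z k ω - zhat k ω‖) atTop (𝓝 0) := by
      simpa using hun.add (hread.const_mul (1 + r))
    refine squeeze_zero_norm (fun k => ?_) h3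
    have e : z k ω - T (z k ω) = u k + ((z k ω - zhat k ω) - (T (z k ω) - T (zhat k ω))) := by
      simp only [hu]; abel
    rw [e]
    refine (norm_add_le _ _).trans (add_le_add_right ((norm_sub_le _ _).trans ?_) _)
    have := h.norm_map_sub_le (z k ω) (zhat k ω)
    linarith

variable [FiniteDimensional ℝ F] [MeasurableSingletonClass ι]

theorem bddMeas_step_sq
    (h : StaleBlockIteration P ℱ M T lo r w N ηmin ηmax τ q U s z₀ sel z zhat) {k d : ℕ}
    (hd : d < k) : BddMeas (ℱ k) (fun ω => ‖z (d + 1) ω - z d ω‖ ^ 2) :=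
  have : ProperSpace F := FiniteDimensional.proper ℝ F
  (((h.bddMeas_iterate (d + 1)).mono (ℱ.mono hd)).sub
    ((h.bddMeas_iterate d).mono (ℱ.mono hd.le))).comp (continuous_norm.pow 2)

theorem bddMeas_weightedHistory
    (h : StaleBlockIteration P ℱ M T lo r w N ηmin ηmax τ q U s z₀ sel z zhat) (k : ℕ) :
    BddMeas (ℱ k) (fun ω => weightedHistory τ (fun d => ‖z (d + 1) ω - z d ω‖ ^ 2) k) :=
  BddMeas.sum _ fun _ hd => (h.bddMeas_step_sq (Finset.mem_range.1 hd)).comp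
    (continuous_const_mul _)

theorem bddMeas_sum_residual
    (h : StaleBlockIteration P ℱ M T lo r w N ηmin ηmax τ q U s z₀ sel z zhat) {j k : ℕ}
    (hj : j ≤ k + 1) :
    BddMeas (ℱ k) (fun ω => ∑ l ∈ Finset.range j, quadForm M (zhat l ω - T (zhat l ω))) :=
  have : ProperSpace F := FiniteDimensional.proper ℝ F
  BddMeas.sum _ fun l hl => ((h.bddMeas_residual l).mono
    (ℱ.mono (by have := Finset.mem_range.1 hl; omega))).comp (continuous_quadForm M)

theorem bddMeas_lyapunov
    (h : StaleBlockIteration P ℱ M T lo r w N ηmin ηmax τ q U s z₀ sel z zhat) (c δ : ℝ) (zs : F)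
    (k : ℕ) : BddMeas (ℱ k) (lyapunov M T c δ τ z zhat zs k) :=
  have : ProperSpace F := FiniteDimensional.proper ℝ F
  (((h.bddMeas_iterate k).comp
    ((continuous_quadForm M).comp (continuous_id.sub continuous_const))).add
    ((h.bddMeas_weightedHistory k).comp (continuous_const_mul c))).add
    ((h.bddMeas_sum_residual (Nat.le_succ k)).comp (continuous_const_mul δ))

/-- With the block index i frozen, the next value is known at time k; this is what `condExp_select`
requires. -/
theorem bddMeas_lyapunovNext
    (h : StaleBlockIteration P ℱ M T lo r w N ηmin ηmax τ q U s z₀ sel z zhat) (c δ : ℝ) (zs : F)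
    (k : ℕ) (i : ι) : BddMeas (ℱ k) (lyapunovNext M T c δ N τ q U s z zhat zs k i) := by
  have : ProperSpace F := FiniteDimensional.proper ℝ F
  have hstep : BddMeas (ℱ k) fun ω =>
      (s k / (N * q i)) • U i (zhat k ω - T (zhat k ω)) :=
    (h.bddMeas_residual k).comp
      ((LinearMap.continuous_of_finiteDimensional (U i)).const_smul (s k / (N * q i)))
  have h1 := (((h.bddMeas_iterate k).sub hstep).sub (BddMeas.const zs)).comp
    (continuous_quadForm M)
  have h2 := ((hstep.comp (continuous_norm.pow 2)).comp
    (continuous_const_mul (τ : ℝ))).comp (continuous_const_mul c)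
  have h3 := ((h.bddMeas_weightedHistory k).sub (BddMeas.sum (staleWindow τ k) fun d hd =>
    h.bddMeas_step_sq (k := k) (d := d) (by
      rw [staleWindow, Finset.mem_filter, Finset.mem_range] at hd
      exact hd.1))).comp (continuous_const_mul c)
  have h4 := (h.bddMeas_sum_residual (le_refl (k + 1))).comp (continuous_const_mul δ)
  exact (h1.add h2).add (h3.add h4)

variable [IsProbabilityMeasure P]

theorem supermartingale_lyapunov
    (h : StaleBlockIteration P ℱ M T lo r w N ηmin ηmax τ q U s z₀ sel z zhat) {zs : F}
    (hzs : T zs = zs) :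
    Supermartingale (lyapunov M T (lo * (r * w)) (decrease r w N ηmin ηmax τ) τ z zhat zs) ℱ P := by
  refine supermartingale_nat (fun k => (h.bddMeas_lyapunov _ _ zs k).1)
    (fun k => (h.bddMeas_lyapunov _ _ zs k).integrable (ℱ.le k)) fun k => ?_
  have h1 := condExp_select (P := P) (ℱ.le k) ((h.sel_measurable k).mono (ℱ.le (k + 1)) le_rfl)
    (fun i => (h.q_pos i).le) (h.sel_law k) (h.sel_indep k)
    (h.bddMeas_lyapunovNext (lo * (r * w)) (decrease r w N ηmin ηmax τ) zs k)
  have h2 : lyapunov M T (lo * (r * w)) (decrease r w N ηmin ηmax τ) τ z zhat zs (k + 1) = _ :=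
    funext (h.lyapunov_succ _ _ zs k)
  rw [h2]
  filter_upwards [h1] with ω hω
  rw [hω]
  exact h.sum_lyapunovNext_le hzs k ω

/-- The asynchronous block iteration converges almost surely to a fixed point. -/
theorem convergesASInto
    (h : StaleBlockIteration P ℱ M T lo r w N ηmin ηmax τ q U s z₀ sel z zhat)
    (hfix : {x | T x = x}.Nonempty) : ConvergesASInto P z {x | T x = x} := by
  have : ProperSpace F := FiniteDimensional.proper ℝ F
  have hclosed : IsClosed {x | T x = x} := isClosed_eq h.continuous_map continuous_id
  refine convergesASInto_of_ae_tendsto hclosed hfix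
    (fun k => (h.bddMeas_iterate k).1.mono (ℱ.le k)) ?_
  -- The exceptional null set depends on the fixed point, so only countably many may be used.
  obtain ⟨D, hDsub, hDcount, hDdense⟩ :=
    (TopologicalSpace.IsSeparable.of_separableSpace {x | T x = x}).exists_countable_dense_subset
  have hDne : D.Nonempty := by
    rw [← closure_nonempty_iff]
    exact hfix.mono hDdense
  have hc : 0 < lo * (r * w) := mul_pos h.lo_pos (mul_pos h.r_pos h.w_pos)
  have hae : ∀ᵐ ω ∂P, ∀ p ∈ D, ∃ L, Tendsto (fun k => lyapunov M T (lo * (r * w))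
      (decrease r w N ηmin ηmax τ) τ z zhat p k ω) atTop (𝓝 L) :=
    (ae_ball_iff hDcount).2 fun p hp => exists_ae_tendsto_of_nonneg_supermartingale
      (h.supermartingale_lyapunov (hDsub hp))
      fun k ω => h.lyapunov_nonneg hc.le h.decrease_pos.le p k ω
  filter_upwards [hae] with ω hω
  have hboth := fun p hp => h.tendsto_of_tendsto_lyapunov hc h.decrease_pos (hω p hp).choose_spec
  obtain ⟨p, hp⟩ := hDne
  exact exists_tendsto_of_tendsto_quadForm h.symm h.posDef h.lo_pos (fun z => (h.bounds z).1)
    h.continuous_map ⟨p, hp⟩ hDdense (fun p hp => (hboth p hp).1) (hboth p hp).2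

end StaleBlockIteration

/-! ### Coordinate scalings as block operators, and the error of delayed reads. -/

theorem sum_Ico_telescope {E : Type*} [AddCommGroup E] (φ : ℕ → E) {a b : ℕ} (hab : a ≤ b) :
    ∑ d ∈ Finset.Ico a b, (φ (d + 1) - φ d) = φ b - φ a := by
  induction b, hab using Nat.le_induction with
  | base => simp
  | succ b hb ih => rw [Finset.sum_Ico_succ_top hb, ih]; abel

instance measurableSingletonClass_sum {α β : Type*} [MeasurableSpace α] [MeasurableSpace β]
    [MeasurableSingletonClass α] [MeasurableSingletonClass β] :
    MeasurableSingletonClass (α ⊕ β) where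
  measurableSet_singleton x := by
    rcases x with x | x
    · rw [← Set.image_singleton, measurableSet_inl_image]
      exact measurableSet_singleton x
    · rw [← Set.image_singleton, measurableSet_inr_image]
      exact measurableSet_singleton x

theorem PDSpace.ext {m p : ℕ} {H : Fin m → Type*} {G : Fin p → Type*} {v u : PDSpace H G}
    (h1 : ∀ i, v.fst i = u.fst i) (h2 : ∀ j, v.snd j = u.snd j) : v = u := by
  apply (WithLp.equiv 2 (PiLp 2 H × PiLp 2 G)).injective
  exact Prod.ext (PiLp.ext h1) (PiLp.ext h2)

section Scaling

variable {m p : ℕ} {H : Fin m → Type*} {G : Fin p → Type*}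
  [∀ i, NormedAddCommGroup (H i)] [∀ j, NormedAddCommGroup (G j)]

theorem PDSpace.norm_sq (v : PDSpace H G) :
    ‖v‖ ^ 2 = ∑ i, ‖v.fst i‖ ^ 2 + ∑ j, ‖v.snd j‖ ^ 2 := by
  rw [WithLp.prod_norm_sq_eq_of_L2, PiLp.norm_sq_eq_of_L2, PiLp.norm_sq_eq_of_L2]

/-- The coordinate projection onto `H i`, as an additive map. -/
def fstCoord (i : Fin m) : PDSpace H G →+ H i where
  toFun v := v.fst i
  map_zero' := rfl
  map_add' _ _ := rfl

/-- The coordinate projection onto `G j`, as an additive map. -/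
def sndCoord (j : Fin p) : PDSpace H G →+ G j where
  toFun v := v.snd j
  map_zero' := rfl
  map_add' _ _ := rfl

theorem sum_fst_apply {κ : Type*} (s : Finset κ) (v : κ → PDSpace H G) (i : Fin m) :
    (∑ k ∈ s, v k).fst i = ∑ k ∈ s, (v k).fst i :=
  map_sum (fstCoord i) v s

theorem sum_snd_apply {κ : Type*} (s : Finset κ) (v : κ → PDSpace H G) (j : Fin p) :
    (∑ k ∈ s, v k).snd j = ∑ k ∈ s, (v k).snd j :=
  map_sum (sndCoord j) v s

variable [∀ i, InnerProductSpace ℝ (H i)] [∀ j, InnerProductSpace ℝ (G j)]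

/-- Multiplication of every coordinate by a scalar of its own. -/
def scaleCoords (a : Fin m → ℝ) (b : Fin p → ℝ) : PDSpace H G →ₗ[ℝ] PDSpace H G where
  toFun v := WithLp.toLp 2
    (WithLp.toLp 2 fun i => a i • v.fst i, WithLp.toLp 2 fun j => b j • v.snd j)
  map_add' v u := PDSpace.ext (fun i => by simp) (fun j => by simp)
  map_smul' c v := PDSpace.ext (fun i => by simp [smul_smul, mul_comm]) (fun j => by simp [smul_smul, mul_comm])

@[simp] theorem scaleCoords_fst (a : Fin m → ℝ) (b : Fin p → ℝ) (v : PDSpace H G) (i : Fin m) :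
    (scaleCoords a b v).fst i = a i • v.fst i := rfl

@[simp] theorem scaleCoords_snd (a : Fin m → ℝ) (b : Fin p → ℝ) (v : PDSpace H G) (j : Fin p) :
    (scaleCoords a b v).snd j = b j • v.snd j := rfl

theorem norm_scaleCoords_le {a : Fin m → ℝ} {b : Fin p → ℝ} (ha : ∀ i, a i ^ 2 ≤ 1)
    (hb : ∀ j, b j ^ 2 ≤ 1) (v : PDSpace H G) : ‖scaleCoords a b v‖ ≤ ‖v‖ := by
  refine (pow_le_pow_iff_left₀ (norm_nonneg _) (norm_nonneg _) two_ne_zero).1 ?_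
  simp only [PDSpace.norm_sq, scaleCoords_fst, scaleCoords_snd, norm_smul, mul_pow,
    Real.norm_eq_abs, sq_abs]
  exact add_le_add
    (Finset.sum_le_sum fun i _ => mul_le_of_le_one_left (sq_nonneg _) (ha i))
    (Finset.sum_le_sum fun j _ => mul_le_of_le_one_left (sq_nonneg _) (hb j))

variable {ι : Type*} [Fintype ι]

theorem sum_scaleCoords {a : ι → Fin m → ℝ} {b : ι → Fin p → ℝ} (ha : ∀ k, ∑ i, a i k = 1)
    (hb : ∀ j, ∑ i, b i j = 1) (v : PDSpace H G) : ∑ i, scaleCoords (a i) (b i) v = v := by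
  refine PDSpace.ext (fun k => ?_) fun j => ?_
  · simp only [sum_fst_apply, scaleCoords_fst]
    rw [← Finset.sum_smul, ha, one_smul]
  · simp only [sum_snd_apply, scaleCoords_snd]
    rw [← Finset.sum_smul, hb, one_smul]

theorem sum_sq_le_one {c : ι → ℝ} (h0 : ∀ i, 0 ≤ c i) (h1 : ∑ i, c i = 1) :
    ∑ i, c i ^ 2 ≤ 1 := by
  calc ∑ i, c i ^ 2 ≤ (∑ i, c i) ^ 2 := Finset.sum_sq_le_sq_sum_of_nonneg fun i _ => h0 i
    _ = 1 := by rw [h1, one_pow]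

/-- Nonnegative weights with sum 1 have squares summing to at most 1, coordinate by coordinate. -/
theorem sum_norm_scaleCoords_sq_le {a : ι → Fin m → ℝ} {b : ι → Fin p → ℝ}
    (ha0 : ∀ i k, 0 ≤ a i k) (hb0 : ∀ i j, 0 ≤ b i j) (ha : ∀ k, ∑ i, a i k = 1)
    (hb : ∀ j, ∑ i, b i j = 1) (v : PDSpace H G) :
    ∑ i, ‖scaleCoords (a i) (b i) v‖ ^ 2 ≤ ‖v‖ ^ 2 := by
  simp only [PDSpace.norm_sq, scaleCoords_fst, scaleCoords_snd, norm_smul, mul_pow,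
    Real.norm_eq_abs, sq_abs, Finset.sum_add_distrib]
  rw [Finset.sum_comm, Finset.sum_comm (s := Finset.univ) (t := Finset.univ)
    (f := fun i j => b i j ^ 2 * ‖v.snd j‖ ^ 2)]
  simp only [← Finset.sum_mul]
  exact add_le_add
    (Finset.sum_le_sum fun k _ => mul_le_of_le_one_left (sq_nonneg _)
      (sum_sq_le_one (fun i => ha0 i k) (ha k)))
    (Finset.sum_le_sum fun j _ => mul_le_of_le_one_left (sq_nonneg _)
      (sum_sq_le_one (fun i => hb0 i j) (hb j)))

end Scaling

section Reads

variable {m p : ℕ} {H : Fin m → Type*} {G : Fin p → Type*}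
  [∀ i, NormedAddCommGroup (H i)] [∀ j, NormedAddCommGroup (G j)]

theorem sum_staleWindow_ite_smul {E : Type*} [AddCommGroup E] [Module ℝ E] (φ : ℕ → E)
    {τ k d₀ : ℕ} (hd : d₀ ≤ τ) :
    ∑ d ∈ staleWindow τ k, (if k - d₀ ≤ d then (1 : ℝ) else 0) • (φ (d + 1) - φ d)
      = φ k - φ (k - d₀) := by
  simp only [ite_smul, one_smul, zero_smul]
  rw [← Finset.sum_filter, ← sum_Ico_telescope φ (Nat.sub_le k d₀), staleWindow_eq_Ico]
  congr 1
  ext d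
  simp only [Finset.mem_filter, Finset.mem_Ico]
  omega

theorem norm_sub_le_of_inconsistentRead {τ : ℕ} {z : ℕ → PDSpace H G} {k : ℕ}
    {zh : PDSpace H G} (h : InconsistentRead τ z k zh) :
    ‖z k - zh‖ ≤ ∑ d ∈ staleWindow τ k, ‖z (d + 1) - z d‖ := by
  obtain ⟨J, hJ, rfl⟩ := h
  rw [sub_add_cancel_left, norm_neg]
  refine (norm_sum_le_of_le J fun d _ => (norm_sub_rev (z d) (z (d + 1))).le).trans ?_
  refine Finset.sum_le_sum_of_subset_of_nonneg (fun d hd => ?_) fun _ _ _ => norm_nonneg _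
  rw [staleWindow, Finset.mem_filter, Finset.mem_range]
  exact hJ d hd

variable [∀ i, InnerProductSpace ℝ (H i)] [∀ j, InnerProductSpace ℝ (G j)]

/-- Each coordinate telescopes over its own part of the window, so the error is a sum of steps
masked by 0/1 weights, and a mask does not increase the norm. -/
theorem norm_sub_le_of_coordinateDelayed {τ : ℕ} {z : ℕ → PDSpace H G} {k : ℕ}
    {zh : PDSpace H G} (h : CoordinateDelayed τ z k zh) :
    ‖z k - zh‖ ≤ ∑ d ∈ staleWindow τ k, ‖z (d + 1) - z d‖ := by
  choose dx hdx hx using h.1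
  choose ds hds hs using h.2
  have hsum : z k - zh = ∑ d ∈ staleWindow τ k,
      scaleCoords (fun i => if k - dx i ≤ d then 1 else 0)
        (fun j => if k - ds j ≤ d then 1 else 0) (z (d + 1) - z d) := by
    refine PDSpace.ext (fun i => ?_) fun j => ?_
    · rw [sum_fst_apply, WithLp.sub_fst, PiLp.sub_apply, hx,
        ← sum_staleWindow_ite_smul (fun l => (z l).fst i) (hdx i)]
      rfl
    · rw [sum_snd_apply, WithLp.sub_snd, PiLp.sub_apply, hs,
        ← sum_staleWindow_ite_smul (fun l => (z l).snd j) (hds j)]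
      rfl
  rw [hsum]
  refine norm_sum_le_of_le _ fun d _ => norm_scaleCoords_le (fun i => ?_) (fun j => ?_) _
  · split_ifs <;> simp
  · split_ifs <;> simp

end Reads

/-! ### From asynchronous runs to the abstract iteration. -/

section Convergence

variable {m p : ℕ} {H : Fin m → Type*} {G : Fin p → Type*}
  [∀ i, NormedAddCommGroup (H i)] [∀ i, InnerProductSpace ℝ (H i)]
  [∀ i, FiniteDimensional ℝ (H i)]
  [∀ j, NormedAddCommGroup (G j)] [∀ j, InnerProductSpace ℝ (G j)]
  [∀ j, FiniteDimensional ℝ (G j)]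
  {Ω : Type*} [mΩ : MeasurableSpace Ω] {P : Measure Ω} [IsProbabilityMeasure P]
  {ℱ : Filtration ℕ mΩ} {ι : Type*} [Fintype ι] [MeasurableSpace ι] [MeasurableSingletonClass ι]

/-- Almost sure convergence of an asynchronous run of a block iteration whose blocks are weighted
coordinates. -/
theorem IsAsyncRun.convergesASInto {M : PDSpace H G →ₗ[ℝ] PDSpace H G} (hM : M.IsSymmetric)
    (hpos : PosDefOp M) {T : PDSpace H G → PDSpace H G} (hT : NonexpansiveUnder M T)
    (hfix : {x | T x = x}.Nonempty) {q : ι → ℝ} {ηmin ηmax : ℝ} {τ : ℕ} {s : ℕ → ℝ}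
    {upd : ℕ → ι → PDSpace H G → PDSpace H G → PDSpace H G} {z₀ : PDSpace H G}
    {sel : ℕ → Ω → ι} {z zhat : ℕ → Ω → PDSpace H G} (hmin : 0 < ηmin)
    (hmax : ηmax < stepBound q τ (condNumber M)) (hs : ∀ k, s k ∈ Set.Icc ηmin ηmax)
    {a : ι → Fin m → ℝ} {b : ι → Fin p → ℝ} (ha0 : ∀ i k, 0 ≤ a i k) (hb0 : ∀ i j, 0 ≤ b i j)
    (ha : ∀ k, ∑ i, a i k = 1) (hb : ∀ j, ∑ i, b i j = 1)
    (hupd : ∀ k i z zh, upd k i z zh =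
      z - (s k / (Fintype.card ι * q i)) • scaleCoords (a i) (b i) (zh - T zh))
    (hrun : IsAsyncRun P ℱ q τ upd z₀ sel z zhat) : ConvergesASInto P z {x | T x = x} := by
  -- In the zero space there are no eigenvalues to provide spectral bounds, but convergence is
  -- trivial.
  rcases subsingleton_or_nontrivial (PDSpace H G) with hsub | hnt
  · obtain ⟨x, hx⟩ := hfix
    refine ⟨fun _ => x, @measurable_const _ _ (borel _) _ _, fun _ => hx, ae_of_all _ fun ω => ?_⟩
    have : (fun k => z k ω) = fun _ => x := funext fun k => Subsingleton.elim _ _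
    rw [this]
    exact tendsto_const_nhds
  obtain ⟨lo, hi, hlo, hlohi, hκ, hbd⟩ := exists_spectral_bounds hM hpos
  have hne : Nonempty ι := by
    by_contra hempty
    rw [not_nonempty_iff] at hempty
    simpa using hrun.q_sum
  set qm : ℝ := ⨅ i, q i with hqm
  have hqm_le : ∀ i, qm ≤ q i := fun i => ciInf_le (Set.finite_range q).bddBelow i
  have hqm_pos : 0 < qm := by
    obtain ⟨i, hi⟩ := exists_eq_ciInf_of_finite (f := q)
    rw [hqm, ← hi]
    exact hrun.q_pos i
  have hκ_pos : 0 < condNumber M := by rw [hκ]; exact div_pos (hlo.trans_le hlohi) hlo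
  set r : ℝ := √(condNumber M) with hr
  set w : ℝ := √qm with hw
  have hr_pos : 0 < r := Real.sqrt_pos.2 hκ_pos
  have hw_pos : 0 < w := Real.sqrt_pos.2 hqm_pos
  have hr2 : r ^ 2 = condNumber M := Real.sq_sqrt hκ_pos.le
  have hw2 : w ^ 2 = qm := Real.sq_sqrt hqm_pos.le
  have hhi : r ^ 2 * lo = hi := by rw [hr2, hκ]; field_simp
  have hscheme : StaleBlockIteration P ℱ M T lo r w (Fintype.card ι) ηmin ηmax τ q
      (fun i => scaleCoords (a i) (b i)) s z₀ sel z zhat :=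
    { symm := hM
      posDef := hpos
      nonexpansive := hT
      lo_pos := hlo
      r_pos := hr_pos
      w_pos := hw_pos
      N_pos := Nat.cast_pos.2 Fintype.card_pos
      bounds := fun z => by rw [hhi]; exact hbd z
      q_ge := fun i => by rw [hw2]; exact hqm_le i
      q_sum := hrun.q_sum
      min_pos := hmin
      s_mem := hs
      max_lt := by
        rw [stepBound, Real.sqrt_mul hκ_pos.le, ← hqm, ← hr, ← hw, ← hr2, ← hw2, mul_assoc,
          lt_div_iff₀ (by positivity)] at hmax
        linarith
      sum_block := sum_scaleCoords ha hb
      norm_block := sum_norm_scaleCoords_sq_le ha0 hb0 ha hb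
      sel_measurable := hrun.sel_measurable
      sel_law := hrun.sel_law
      sel_indep := hrun.sel_indep
      read_measurable := hrun.read_measurable
      read_error := fun k ω => (hrun.read_delayed k ω).elim norm_sub_le_of_coordinateDelayed
        norm_sub_le_of_inconsistentRead
      init := hrun.init
      step := fun k ω => by rw [hrun.step, hupd] }
  exact hscheme.convergesASInto hfix

end Convergence

/-! ### Both algorithms as scaled residual steps. -/

section Updates

variable {m p : ℕ} {H : Fin m → Type*} {G : Fin p → Type*}
  [∀ i, NormedAddCommGroup (H i)] [∀ i, InnerProductSpace ℝ (H i)]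
  [∀ j, NormedAddCommGroup (G j)] [∀ j, InnerProductSpace ℝ (G j)]

theorem coordPart_eq_scaleCoords (i : Fin m ⊕ Fin p) (v : PDSpace H G) :
    coordPart i v = scaleCoords (fun k => if i = .inl k then 1 else 0)
      (fun j => if i = .inr j then 1 else 0) v := by
  rcases i with i | i
  · refine PDSpace.ext (fun k => ?_) fun j => by simp [coordPart]
    by_cases hk : i = k
    · subst hk; simp [coordPart]
    · simp [coordPart, hk]
  · refine PDSpace.ext (fun k => by simp [coordPart]) fun j => ?_
    by_cases hk : i = j
    · subst hk; simp [coordPart]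
    · simp [coordPart, hk]

variable [∀ i, CompleteSpace (H i)] [∀ j, CompleteSpace (G j)]

theorem mem_dualNbrs {A : PiLp 2 H →L[ℝ] PiLp 2 G} {i : Fin m} {j : Fin p} :
    j ∈ dualNbrs A i ↔ ∃ u, adjBlock A i j u ≠ 0 := by
  simp [dualNbrs]

theorem mem_primalNbrs {A : PiLp 2 H →L[ℝ] PiLp 2 G} {i : Fin m} {j : Fin p} :
    i ∈ primalNbrs A j ↔ ∃ u, adjBlock A i j u ≠ 0 := by
  simp [primalNbrs]

theorem sum_dualNbrs_adjBlock (A : PiLp 2 H →L[ℝ] PiLp 2 G) (i : Fin m) (v : PiLp 2 G) :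
    ∑ j ∈ dualNbrs A i, adjBlock A i j (v j) = A.adjoint v i := by
  classical
  have hv : v = ∑ j, PiLp.single 2 j (v j) := by
    refine PiLp.ext fun j => ?_
    rw [WithLp.ofLp_sum, Finset.sum_apply, Finset.sum_eq_single j]
    · simp
    · intro l _ hl
      simp [hl.symm]
    · simp
  have h1 : A.adjoint v i = ∑ j, adjBlock A i j (v j) := by
    conv_lhs => rw [hv]
    rw [map_sum, WithLp.ofLp_sum, Finset.sum_apply]
    rfl
  rw [h1]
  refine Finset.sum_subset (Finset.subset_univ _) fun j _ hj => ?_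
  simp only [mem_dualNbrs, not_exists, not_not] at hj
  exact hj _

/-- Separability makes the local proximal steps components of the full operator, and the dual blocks
outside 𝕁(i) contribute nothing to (Aᵀ·)_i. The local computation therefore gives exactly the needed
coordinates of the full map. -/
theorem overlapUpdate_eq [∀ i, FiniteDimensional ℝ (H i)] [∀ j, FiniteDimensional ℝ (G j)]
    {f : PiLp 2 H → ℝ} {g : PiLp 2 H → EReal} {h : PiLp 2 G → EReal}
    {gb : ∀ i, H i → EReal} {hb : ∀ j, G j → EReal} {A : PiLp 2 H →L[ℝ] PiLp 2 G} {η γ : ℝ}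
    (hg : ClosedProperConvex g) (hh : ClosedProperConvex (conj h)) (hη : 0 < η) (hγ : 0 < γ)
    (hgb : ∀ x, g x = ∑ i, gb i (x i)) (hhb : ∀ s, conj h s = ∑ j, hb j (s j))
    (ρ : Fin m → Fin p → ℝ) (q : Fin m → ℝ) (c : ℝ) (i : Fin m) (z zh : PDSpace H G) :
    overlapUpdate f gb hb A η γ ρ q c i z zh =
      z - (c / (m * q i)) • scaleCoords (fun k => if i = k then 1 else 0)
        (fun j => if j ∈ dualNbrs A i then ρ i j else 0) (zh - condatVu f g h A η γ zh) := by
  have hst : ∀ j, prox γ (hb j) (zh.snd j + γ • (A zh.fst) j)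
      = (condatVu f g h A η γ zh).snd j := fun j =>
    prox_component hh hhb hγ (zh.snd + γ • A zh.fst) j
  have hxt : ∀ a, prox η (gb a) (zh.fst a - η • ((gradient f zh.fst) a +
      ∑ j ∈ dualNbrs A a, adjBlock A a j
        ((2 : ℝ) • (condatVu f g h A η γ zh).snd j - zh.snd j)))
      = (condatVu f g h A η γ zh).fst a := by
    intro a
    have h1 := sum_dualNbrs_adjBlock A a ((2 : ℝ) • (condatVu f g h A η γ zh).snd - zh.snd)
    simp only [PiLp.sub_apply, PiLp.smul_apply] at h1
    rw [h1]
    exact prox_component hg hgb hη (zh.fst - η • (gradient f zh.fst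
      + A.adjoint ((2 : ℝ) • (condatVu f g h A η γ zh).snd - zh.snd))) a
  simp only [overlapUpdate, hst, hxt]
  refine PDSpace.ext (fun k => ?_) fun j => ?_
  · by_cases hk : k = i
    · subst hk
      simp
      module
    · simp [hk, Ne.symm hk]
  · by_cases hj : j ∈ dualNbrs A i
    · simp [hj]
      module
    · simp [hj]

/-- The relations j ∈ 𝕁(i) and i ∈ 𝕀(j) coincide; thus the normalisation of ρ becomes ∑ U_i = I on
the dual coordinates. -/
theorem sum_dualNbrs_ite {A : PiLp 2 H →L[ℝ] PiLp 2 G} {ρ : Fin m → Fin p → ℝ} (j : Fin p) :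
    ∑ i, (if j ∈ dualNbrs A i then ρ i j else 0) = ∑ i ∈ primalNbrs A j, ρ i j := by
  rw [← Finset.sum_filter]
  congr 1
  ext i
  rw [Finset.mem_filter, mem_dualNbrs, mem_primalNbrs]
  simp only [Finset.mem_univ, true_and]

end Updates

end AsyncPD

theorem mainTheorem1 {m p : ℕ} {H : Fin m → Type*} {G : Fin p → Type*}
    [∀ i, NormedAddCommGroup (H i)] [∀ i, InnerProductSpace ℝ (H i)]
    [∀ i, CompleteSpace (H i)] [∀ i, FiniteDimensional ℝ (H i)]
    [∀ j, NormedAddCommGroup (G j)] [∀ j, InnerProductSpace ℝ (G j)]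
    [∀ j, CompleteSpace (G j)] [∀ j, FiniteDimensional ℝ (G j)]
    {Ω : Type*} [mΩ : MeasurableSpace Ω] (P : Measure Ω) [IsProbabilityMeasure P]
    (ℱ : Filtration ℕ mΩ)
    (f : PiLp 2 H → ℝ) (g : PiLp 2 H → EReal) (h : PiLp 2 G → EReal)
    (A : PiLp 2 H →L[ℝ] PiLp 2 G) (β : NNReal) (η γ : ℝ) (τ : ℕ)
    (hf_convex : ConvexOn ℝ Set.univ f) (hf_diff : Differentiable ℝ f)
    (hf_lip : LipschitzWith β (gradient f))
    (hg : AsyncPD.ClosedProperConvex g) (hh : AsyncPD.ClosedProperConvex (AsyncPD.conj h))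
    (hη : 0 < η) (hγ : 0 < γ)
    (hM : AsyncPD.PosDefOp (AsyncPD.metric A η γ))
    (hT : AsyncPD.NonexpansiveUnder (AsyncPD.metric A η γ) (AsyncPD.condatVu f g h A η γ))
    (hsol : (AsyncPD.solutionSet f g h A).Nonempty) :
    -- the algorithm with `m + p` coordinates
    (∀ (q : Fin m ⊕ Fin p → ℝ) (ηmin ηmax : ℝ) (step : ℕ → ℝ) (z₀ : AsyncPD.PDSpace H G)
      (sel : ℕ → Ω → Fin m ⊕ Fin p) (z zhat : ℕ → Ω → AsyncPD.PDSpace H G),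
      0 < ηmin → ηmin ≤ ηmax →
      ηmax < AsyncPD.stepBound q τ (AsyncPD.condNumber (AsyncPD.metric A η γ)) →
      (∀ k, step k ∈ Set.Icc ηmin ηmax) →
      AsyncPD.IsAsyncRun P ℱ q τ
        (fun k => AsyncPD.coordUpdate (AsyncPD.condatVu f g h A η γ) q (step k))
        z₀ sel z zhat →
      AsyncPD.ConvergesASInto P z (AsyncPD.solutionSet f g h A)) ∧
    -- the algorithm with `m` overlapping blocks
    (∀ (gb : ∀ i, H i → EReal) (hb : ∀ j, G j → EReal) (ρ : Fin m → Fin p → ℝ)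
      (q : Fin m → ℝ) (ηmin ηmax : ℝ) (step : ℕ → ℝ) (z₀ : AsyncPD.PDSpace H G)
      (sel : ℕ → Ω → Fin m) (z zhat : ℕ → Ω → AsyncPD.PDSpace H G),
      (∀ x, g x = ∑ i, gb i (x i)) →
      (∀ s, AsyncPD.conj h s = ∑ j, hb j (s j)) →
      (∀ i j, 0 ≤ ρ i j) →
      (∀ j, ∑ i ∈ AsyncPD.primalNbrs A j, ρ i j = 1) →
      0 < ηmin → ηmin ≤ ηmax →
      ηmax < AsyncPD.stepBound q τ (AsyncPD.condNumber (AsyncPD.metric A η γ)) →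
      (∀ k, step k ∈ Set.Icc ηmin ηmax) →
      AsyncPD.IsAsyncRun P ℱ q τ
        (fun k => AsyncPD.overlapUpdate f gb hb A η γ ρ q (step k))
        z₀ sel z zhat →
      AsyncPD.ConvergesASInto P z (AsyncPD.solutionSet f g h A)) ∧
    -- the solutions `z = (x, s)` do solve the minimization problem
    (AsyncPD.ClosedProperConvex h → ∀ z ∈ AsyncPD.solutionSet f g h A,
      IsMinOn (fun x => (f x : EReal) + g x + h (A x)) Set.univ z.fst) := by
  have hfix : {x | AsyncPD.condatVu f g h A η γ x = x} = AsyncPD.solutionSet f g h A :=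
    Set.ext fun z => AsyncPD.condatVu_eq_self_iff hg hh hη hγ z
  have hM' := AsyncPD.metric_isSymmetric A η γ
  rw [← hfix] at hsol ⊢
  refine ⟨?_, ?_, ?_⟩
  · intro q ηmin ηmax step z₀ sel z zhat hmin _ hmax hstep hrun
    refine hrun.convergesASInto hM' hM hT hsol hmin hmax hstep
      (a := fun i k => if i = .inl k then 1 else 0) (b := fun i j => if i = .inr j then 1 else 0)
      (fun i k => by split_ifs <;> simp) (fun i k => by split_ifs <;> simp)
      (fun k => by simp) (fun k => by simp) fun k i z zh => ?_
    rw [AsyncPD.coordUpdate, AsyncPD.coordPart_eq_scaleCoords]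
    simp
  · intro gb hb ρ q ηmin ηmax step z₀ sel z zhat hgb hhb hρ hρ1 hmin _ hmax hstep hrun
    refine hrun.convergesASInto hM' hM hT hsol hmin hmax hstep
      (a := fun i k => if i = k then 1 else 0)
      (b := fun i j => if j ∈ AsyncPD.dualNbrs A i then ρ i j else 0)
      (fun i k => by split_ifs <;> simp) (fun i j => by split_ifs <;> simp [hρ])
      (fun k => by simp) (fun j => by rw [AsyncPD.sum_dualNbrs_ite, hρ1]) fun k i z zh => ?_
    rw [AsyncPD.overlapUpdate_eq hg hh hη hγ hgb hhb, Fintype.card_fin]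
  · intro hcpc z hz
    rw [hfix] at hz
    exact AsyncPD.isMinOn_of_mem_solutionSet hf_convex hf_diff hg hh hcpc hz
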